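/- Let $\mathcal S=\{(\hat\rho_x,p_x)\}_{x\in\mathcal X}$ be a quantum source: $\mathcal X$ is a finite alphabet, $p$ a probability distribution on it, and the $\hat\rho_x$ are density operators on a finite-dimensional Hilbert space $\mathcal H$. Put $\hat\rho=\sum_x p_x\hat\rho_x$, $S(\hat\sigma)=-\operatorname{Tr}\hat\sigma\log_2\hat\sigma$, and let $\chi(\mathcal S)=S(\hat\rho)-\sum_x p_xS(\hat\rho_x)$ be the Holevo information. For $\underline x\in\mathcal X^N$ let $\hat\rho_{\underline x}=\bigotimes_n\hat\rho_{x_n}$. Given $\delta>0$, let $\hat\Pi$ be the projector on the span of the product eigenvectors of $\hat\rho^{\otimes N}$ whose eigenvalue $\lambda>0$ satisfies $|-\frac1N\log_2\lambda-S(\hat\rho)|\le\delta$, and let $\hat\Pi_{\underline x}$ be the projector on the span of the product eigenvectors of $\hat\rho_{\underline x}$ whose eigenvalue $\lambda>0$ satisfies $|-\frac1N\log_2\lambda-\sum_xp_xS(\hat\rho_x)|\le\delta$. Let $R$ be a rate and $u_F=\lceil NR\rceil$ (with $u_F=0$ if $NR<0$). A code $\mathcal C$ consists of $M=2^{u_F}$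 codewords $\underline x^{(\underline k)}\in\mathcal X^N$ labelled by the bit strings $\underline k=(k_1,\dots,k_{u_F})$; write $\hat\rho_{\underline k}$, $\hat\Pi_{\underline k}$ for $\hat\rho_{\underline x^{(\underline k)}}$, $\hat\Pi_{\underline x^{(\underline k)}}$. Let $\langle\cdot\rangle_{\mathcal S}$ be the average over codes all of whose letters are independent samples of $p$. For a prefix $k_{(1,u)}=(k_1,\dots,k_u)$ let $\hat S^{(u)}_{k_{(1,u)}}$ be the sum of $\hat\Pi_{\underline k'}$ over all strings $\underline k'$ with this prefix, and let $$\hat T^{(u)}_{k_{(1,u)}}=\bigl(\hat S^{(u-1)}_{k_{(1,u-1)}}\bigr)^{-1/2}\,\hat S^{(u)}_{k_{(1,u)}}\,\bigl(\hat S^{(u-1)}_{k_{(1,u-1)}}\bigr)^{-1/2},\qquad 1\le u\le u_F,$$ where the inverse is the pseudo-inverse. The binary-tree decoder measures at step $u$, given previous outcomes $k_{(1,u-1)}$, with the operators $\hat T^{(u)}_{k_{(1,u-1)},0}$, $\hat T^{(u)}_{k_{(1,u-1)},1}$ and $\hat{\mathbf 1}-\hat T^{(u)}_{k_{(1,u-1)},0}-\hat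 T^{(u)}_{k_{(1,u-1)},1}$ (failure). It outputs $\underline k$ with the operator $\hat G_{\underline k}=\bigl|\sqrt{\hat T^{(u_F)}_{k_{(1,u_F)}}}\cdots\sqrt{\hat T^{(1)}_{k_1}}\bigr|^2$, where $|\hat A|^2=\hat A^\dagger\hat A$, and has success probability $P_{succ}(\mathcal C)=\frac1M\sum_{\underline k}\operatorname{Tr}[\hat G_{\underline k}\hat\rho_{\underline k}]$. **Lemma.** Let $R<\chi(\mathcal S)$. Then there are $\delta>0$ with $R<\chi(\mathcal S)-2\delta$, and for every such $\delta$ the following hold. 1. At each step the three operators are positive semidefinite (they sum to $\hat{\mathbf 1}$ by definition), and $\hat T^{(u)}_{k_{(1,u-1)},0}+\hat T^{(u)}_{k_{(1,u-1)},1}$ acts as the identity on the range of $\hat S^{(u-1)}_{k_{(1,u-1)}}$. This holds for every code, of any length and any number $2^m$ of codewords. 2. There is a function $\epsilon(N)>0$ with $\epsilon(N)=o(N^{-2})$ as $N\to\infty$ such that, for all $N$, all $u\in\{1,\dots,u_F\}$ and all strings $\underline k$, $$\Bigl\langle\operatorname{Tr}\bigl[\hat T^{(u)}_{k_{(1,u)}}\,\hat\Pi\,\hat\rho_{\underline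 k}\,\hat\Pi\bigr]\Bigr\rangle_{\mathcal S}\ \ge\ 1-\epsilon(N).$$ 3. Consequently the decoder achieves the Holevo bound: $\lim_{N\to\infty}\langle P_{succ}(\mathcal C)\rangle_{\mathcal S}=1$. -/

import Mathlib

open scoped BigOperators Matrix Topology ComplexOrder
open Asymptotics

noncomputable section

/-- A quantum source with finite alphabet `X` on the Hilbert space `ℂ^d`: letter `x` is emitted with
probability `prob x` and is encoded in the density operator `state x`. -/
structure QuantumSource (X d : Type*) [Fintype X] [Fintype d] where
  prob : X → ℝ
  prob_nonneg : ∀ x, 0 ≤ prob x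
  prob_sum : ∑ x, prob x = 1
  state : X → Matrix d d ℂ
  state_posSemidef : ∀ x, (state x).PosSemidef
  state_trace : ∀ x, (state x).trace = 1

/-- Von Neumann entropy in bits, i.e. the Shannon entropy of the eigenvalues. -/
def vonNeumannEntropy {d : Type*} [Fintype d] [DecidableEq d] {A : Matrix d d ℂ}
    (hA : A.IsHermitian) : ℝ :=
  -∑ i, hA.eigenvalues i * Real.logb 2 (hA.eigenvalues i)

/-- The tensor product `A 0 ⊗ ⋯ ⊗ A (N-1)`, as a matrix indexed by sequences. -/
def tensorMatrix {d : Type*} {N : ℕ} (A : Fin N → Matrix d d ℂ) :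
    Matrix (Fin N → d) (Fin N → d) ℂ :=
  Matrix.of fun i j => ∏ n, A n (i n) (j n)

/-- The product vector `e_{j 0} ⊗ ⋯ ⊗ e_{j (N-1)}`, where `e_{j n}` is the `j n`-th vector of the
orthonormal eigenbasis of `A n`. -/
def eigenSequence {d : Type*} [Fintype d] [DecidableEq d] {N : ℕ} {A : Fin N → Matrix d d ℂ}
    (hA : ∀ n, (A n).IsHermitian) (j : Fin N → d) : (Fin N → d) → ℂ :=
  fun i => ∏ n, (hA n).eigenvectorBasis (j n) (i n)

/-- `j` labels an eigenvalue sequence whose sample entropy differs from `h` by at most `δ`.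
A sequence of zero weight has infinite sample entropy, hence is never typical. -/
def IsTypicalSequence {d : Type*} [Fintype d] [DecidableEq d] {N : ℕ} {A : Fin N → Matrix d d ℂ}
    (hA : ∀ n, (A n).IsHermitian) (h δ : ℝ) (j : Fin N → d) : Prop :=
  (∀ n, 0 < (hA n).eigenvalues (j n)) ∧
    |-(1 / (N : ℝ)) * ∑ n, Real.logb 2 ((hA n).eigenvalues (j n)) - h| ≤ δ

open Classical in
/-- The projector on the span of the typical eigenstate-sequences of `A 0 ⊗ ⋯ ⊗ A (N-1)`. -/
def typicalProjector {d : Type*} [Fintype d] [DecidableEq d] {N : ℕ} {A : Fin N → Matrix d d ℂ}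
    (hA : ∀ n, (A n).IsHermitian) (h δ : ℝ) : Matrix (Fin N → d) (Fin N → d) ℂ :=
  ∑ j : Fin N → d with IsTypicalSequence hA h δ j,
    Matrix.vecMulVec (eigenSequence hA j) (star (eigenSequence hA j))

/-- The pseudo-inverse square root of a positive semidefinite matrix: eigenvalues `t ≠ 0` go to
`1 / √t`, and the kernel is preserved. -/
def pinvSqrt {n : Type*} [Fintype n] [DecidableEq n] (A : Matrix n n ℂ) : Matrix n n ℂ :=
  cfc (fun t : ℝ => if t = 0 then 0 else 1 / √t) A

/-- The positive square root of a positive semidefinite matrix. -/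
def psdSqrt {n : Type*} [Fintype n] [DecidableEq n] (A : Matrix n n ℂ) : Matrix n n ℂ :=
  cfc (fun t : ℝ => √t) A

/-- A code of `2 ^ m` codewords of length `N`, labelled by bit strings of length `m`. -/
abbrev TreeCode (X : Type*) (N m : ℕ) : Type _ := (Fin m → Bool) → (Fin N → X)

/-- The element `|√T_m ⋯ √T_1|²` of a nested measurement, along one branch of the tree;
`T u` is the operator of step `u + 1`, and `|A|² = A† A`. -/
def nestedElement {n : Type*} [Fintype n] [DecidableEq n] {m : ℕ} (T : Fin m → Matrix n n ℂ) :
    Matrix n n ℂ :=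
  ((List.ofFn fun u => psdSqrt (T u)).reverse.prod)ᴴ *
    (List.ofFn fun u => psdSqrt (T u)).reverse.prod

namespace QuantumSource

variable {X d : Type*} [Fintype X] [Fintype d] (S : QuantumSource X d)

/-- The average state of the source. -/
def avgState : Matrix d d ℂ := ∑ x, (S.prob x : ℂ) • S.state x

theorem avgState_isHermitian : S.avgState.IsHermitian := by
  unfold avgState Matrix.IsHermitian
  rw [Matrix.conjTranspose_sum]
  refine Finset.sum_congr rfl fun x _ => ?_
  rw [Matrix.conjTranspose_smul, (S.state_posSemidef x).isHermitian.eq,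
    Complex.star_def, Complex.conj_ofReal]

variable [DecidableEq d]

/-- The entropy of the average state. -/
def avgStateEntropy : ℝ := vonNeumannEntropy S.avgState_isHermitian

/-- The average entropy of the states of the source. -/
def condEntropy : ℝ := ∑ x, S.prob x * vonNeumannEntropy (S.state_posSemidef x).isHermitian

/-- The Holevo information of the source. -/
def holevoInfo : ℝ := S.avgStateEntropy - S.condEntropy

/-- The product state encoding the sequence `x`. -/
def codewordState {N : ℕ} (x : Fin N → X) : Matrix (Fin N → d) (Fin N → d) ℂ :=
  tensorMatrix fun n => S.state (x n)

/-- The projector on the `δ`-typical subspace of `N` copies of the average state. -/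
def typProj (N : ℕ) (δ : ℝ) : Matrix (Fin N → d) (Fin N → d) ℂ :=
  typicalProjector (fun _ : Fin N => S.avgState_isHermitian) S.avgStateEntropy δ

/-- The projector on the `δ`-conditionally-typical subspace of the sequence `x`. -/
def condTypProj (δ : ℝ) {N : ℕ} (x : Fin N → X) : Matrix (Fin N → d) (Fin N → d) ℂ :=
  typicalProjector (fun n => (S.state_posSemidef (x n)).isHermitian) S.condEntropy δ

/-- The sum of the conditionally-typical projectors of all the codewords whose label has the same
first `u` bits as `k`. -/
def prefixSum (δ : ℝ) {N m : ℕ} (c : TreeCode X N m) (u : ℕ) (k : Fin m → Bool) :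
    Matrix (Fin N → d) (Fin N → d) ℂ :=
  ∑ k' : Fin m → Bool with ∀ i : Fin m, (i : ℕ) < u → k' i = k i, S.condTypProj δ (c k')

/-- The square-root-measurement operator of step `u + 1`, for the branch given by the first `u + 1`
bits of `k` (it does not depend on the other bits): the sum operator of the subset fixed by
these bits, renormalized by the sum operator of its parent subset. -/
def srmOperator (δ : ℝ) {N m : ℕ} (c : TreeCode X N m) (u : Fin m) (k : Fin m → Bool) :
    Matrix (Fin N → d) (Fin N → d) ℂ :=
  pinvSqrt (S.prefixSum δ c u k) * S.prefixSum δ c (u + 1) k * pinvSqrt (S.prefixSum δ c u k)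

/-- The average of `f` over random codes, whose letters are independent samples of the source. -/
def codeAverage {N m : ℕ} (f : TreeCode X N m → ℝ) : ℝ :=
  ∑ c : TreeCode X N m, (∏ k, ∏ n, S.prob (c k n)) * f c

/-- The success probability of the nested measurement with step operators `T`, for equiprobable
codewords of the code `c`. (The trace of a product of two positive operators is real.) -/
def successProb {N m : ℕ} (c : TreeCode X N m)
    (T : Fin m → (Fin m → Bool) → Matrix (Fin N → d) (Fin N → d) ℂ) : ℝ :=
  1 / (2 : ℝ) ^ m *
    ∑ k, (nestedElement (fun u => T u k) * S.codewordState (c k)).trace.re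

/-- The number of bits (and of decoding steps) at rate `R` and length `N`: `N R`, rounded up. -/
def numBits (R : ℝ) (N : ℕ) : ℕ := ⌈(N : ℝ) * R⌉₊

/-- The sufficient condition for nested decoding with step operators `T` at rate `R`: averaged over
codes, every step operator accepts the state of each codeword of its subset, projected on the
typical subspace, up to an error that vanishes faster than `N⁻²`. -/
def SufficientCondition (R δ : ℝ)
    (T : ∀ {N m : ℕ}, TreeCode X N m → Fin m → (Fin m → Bool) →
      Matrix (Fin N → d) (Fin N → d) ℂ) : Prop :=
  ∃ ε : ℕ → ℝ, (∀ N, 0 < ε N) ∧ ε =o[Filter.atTop] (fun N : ℕ => ((N : ℝ) ^ 2)⁻¹) ∧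
    ∀ (N : ℕ) (u : Fin (numBits R N)) (k : Fin (numBits R N) → Bool),
      1 - ε N ≤ S.codeAverage fun c : TreeCode X N (numBits R N) =>
        (T c u k * (S.typProj N δ * S.codewordState (c k) * S.typProj N δ)).trace.re

end QuantumSource

end

/-! One step. The projector Π_k of the sent codeword lies below the sum operator S of the parent
subset and below that of the child, so T ≥ S^{-1/2} Π_k S^{-1/2}, and the Hayashi–Nagaoka inequality
(`hayashi_nagaoka`) gives 1 - T ≤ 2(1 - Π_k) + 4(S - Π_k). Whatever the depth, S - Π_k is at most
the sum of Π_k' over all k' ≠ k, so a single estimate serves every step.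

Average over codes. The term 1 - Π_k and the insertion of the typical projector Π cost tail
probabilities of sums of independent letters, which decay exponentially (`exists_tail_bound`). In
the interference term the codewords k and k' are independent: averaging over k replaces its state by
ρ^{⊗N}, which Π cuts down below 2^{-N(S(ρ)-δ)}, while Tr Π_k' ≤ 2^{N(∑ p_x S(ρ_x)+δ)}. Each k' thus
contributes at most 2^{-N(χ-2δ)} (`sum_seqProb_interference_le`), and the fewer than 2·2^{NR}
codewords together still contribute an exponentially small amount, as R < χ - 2δ.

Whole decoder. With w = √ρ_k, the success probability is the squared Frobenius norm of √T_m ⋯ √T_1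
w. A step that errs with probability ε moves the vector by at most √ε, and all steps are
contractions, so displacements only add up (`one_sub_le_trace_nestedElement`). There are O(N) steps,
and N√ε → 0 precisely because ε = o(N⁻²). -/

noncomputable section

namespace Matrix

/-! ### Pseudo-inverses, square roots and the Hayashi–Nagaoka inequality. -/

section FunctionalCalculus
open scoped MatrixOrder

variable {n : Type*} [Fintype n] [DecidableEq n]

theorem cfc_mul_cfc (f g : ℝ → ℝ) (A : Matrix n n ℂ) :
    cfc f A * cfc g A = cfc (fun t => f t * g t) A :=
  (cfc_mul f g A (A.finite_real_spectrum.continuousOn f) (A.finite_real_spectrum.continuousOn g)).symm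

theorem isHermitian_cfc (f : ℝ → ℝ) (A : Matrix n n ℂ) : (cfc f A).IsHermitian :=
  cfc_predicate f A

theorem spectrum_nonneg {A : Matrix n n ℂ} (hA : 0 ≤ A) {t : ℝ} (ht : t ∈ spectrum ℝ A) : 0 ≤ t :=
  spectrum_nonneg_of_nonneg hA ht

/-- The support projector of a matrix. -/
def supportProj (A : Matrix n n ℂ) : Matrix n n ℂ := cfc (fun t : ℝ => if t = 0 then 0 else 1) A

theorem supportProj_le_one (A : Matrix n n ℂ) : supportProj A ≤ 1 :=
  cfc_le_one _ A fun t _ => by split_ifs <;> norm_num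

theorem pinvSqrt_isHermitian (A : Matrix n n ℂ) : (pinvSqrt A).IsHermitian := isHermitian_cfc _ A

theorem psdSqrt_nonneg (A : Matrix n n ℂ) : 0 ≤ psdSqrt A :=
  cfc_nonneg fun t _ => Real.sqrt_nonneg t

theorem psdSqrt_isHermitian (A : Matrix n n ℂ) : (psdSqrt A).IsHermitian := isHermitian_cfc _ A

theorem psdSqrt_mul_psdSqrt {A : Matrix n n ℂ} (hA : 0 ≤ A) : psdSqrt A * psdSqrt A = A := by
  have hs : IsSelfAdjoint A := (nonneg_iff_posSemidef.1 hA).1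
  conv_rhs => rw [← cfc_id ℝ A hs]
  rw [psdSqrt, cfc_mul_cfc]
  exact cfc_congr fun t ht => Real.mul_self_sqrt (spectrum_nonneg hA ht)

theorem pinvSqrt_mul_psdSqrt {A : Matrix n n ℂ} (hA : 0 ≤ A) :
    pinvSqrt A * psdSqrt A = supportProj A := by
  rw [psdSqrt, pinvSqrt, cfc_mul_cfc]
  refine cfc_congr fun t ht => ?_
  by_cases h : t = 0
  · simp [h]
  · have : 0 < t := lt_of_le_of_ne (spectrum_nonneg hA ht) (Ne.symm h)
    have := Real.sqrt_ne_zero'.2 this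
    simp [h, this]

theorem psdSqrt_mul_pinvSqrt {A : Matrix n n ℂ} (hA : 0 ≤ A) :
    psdSqrt A * pinvSqrt A = supportProj A := by
  rw [← pinvSqrt_mul_psdSqrt hA, psdSqrt, pinvSqrt, cfc_mul_cfc, cfc_mul_cfc]
  simp only [mul_comm]

theorem supportProj_mul_psdSqrt (A : Matrix n n ℂ) :
    supportProj A * psdSqrt A = psdSqrt A := by
  rw [psdSqrt, supportProj, cfc_mul_cfc]
  refine cfc_congr fun t ht => ?_
  by_cases h : t = 0 <;> simp [h]

theorem supportProj_mul_self {A : Matrix n n ℂ} (hA : 0 ≤ A) : supportProj A * A = A := by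
  have h : supportProj A * (psdSqrt A * psdSqrt A) = psdSqrt A * psdSqrt A := by
    rw [← Matrix.mul_assoc, supportProj_mul_psdSqrt]
  rwa [psdSqrt_mul_psdSqrt hA] at h

theorem pinvSqrt_mul_self {A : Matrix n n ℂ} (hA : 0 ≤ A) : pinvSqrt A * A = psdSqrt A := by
  have h : pinvSqrt A * (psdSqrt A * psdSqrt A) = psdSqrt A := by
    rw [← Matrix.mul_assoc, pinvSqrt_mul_psdSqrt hA, supportProj_mul_psdSqrt]
  rwa [psdSqrt_mul_psdSqrt hA] at h

theorem pinvSqrt_conj_self {A : Matrix n n ℂ} (hA : 0 ≤ A) :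
    pinvSqrt A * A * pinvSqrt A = supportProj A := by
  rw [pinvSqrt_mul_self hA, psdSqrt_mul_pinvSqrt hA]

omit [DecidableEq n] in
theorem conj_nonneg {A : Matrix n n ℂ} (hA : 0 ≤ A) {B : Matrix n n ℂ} (hB : B.IsHermitian) :
    0 ≤ B * A * B := by
  have h := (nonneg_iff_posSemidef.1 hA).mul_mul_conjTranspose_same B
  rw [hB.eq] at h
  exact nonneg_iff_posSemidef.2 h

omit [DecidableEq n] in
theorem mul_conjTranspose_nonneg (A : Matrix n n ℂ) : 0 ≤ A * Aᴴ :=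
  nonneg_iff_posSemidef.2 (posSemidef_self_mul_conjTranspose A)

theorem trace_mul_re_nonneg {A B : Matrix n n ℂ} (hA : 0 ≤ A) (hB : 0 ≤ B) :
    0 ≤ (A * B).trace.re := by
  rw [← psdSqrt_mul_psdSqrt hB, ← Matrix.mul_assoc, Matrix.trace_mul_comm, ← Matrix.mul_assoc]
  exact (Complex.le_def.1 (nonneg_iff_posSemidef.1
    (conj_nonneg hA (isHermitian_cfc _ B))).trace_nonneg).1

theorem trace_mul_re_mono {A B C : Matrix n n ℂ} (hAB : A ≤ B) (hC : 0 ≤ C) :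
    (A * C).trace.re ≤ (B * C).trace.re := by
  have h := trace_mul_re_nonneg (sub_nonneg.2 hAB) hC
  rw [Matrix.sub_mul, Matrix.trace_sub, Complex.sub_re] at h
  linarith

/-- Inserting a projector before a measurement costs at most twice the weight it removes. -/
theorem trace_conj_projector_le {P Q ρ : Matrix n n ℂ} (hP : 0 ≤ P) (hQ : 0 ≤ Q) (hQ1 : Q * Q = Q) (hPle : P ≤ 1)
    (hρ : 0 ≤ ρ) :
    (P * (Q * ρ * Q)).trace.re ≤ 2 * (P * ρ).trace.re + 2 * ((1 - Q) * ρ).trace.re := by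
  have hQh : Q.IsHermitian := (nonneg_iff_posSemidef.1 hQ).1
  have hR : (1 - Q).IsHermitian := isHermitian_one.sub hQh
  have hX : (2 - Q).IsHermitian := by
    have : (2 - Q) = 1 + (1 - Q) := by rw [← one_add_one_eq_two]; abel
    rw [this]; exact isHermitian_one.add hR
  have h1 : 0 ≤ (P * ((2 - Q) * ρ * (2 - Q))).trace.re :=
    trace_mul_re_nonneg hP (conj_nonneg hρ hX)
  have h2 : (P * ((1 - Q) * ρ * (1 - Q))).trace.re ≤ ((1 - Q) * ρ).trace.re := by
    refine (trace_mul_re_mono hPle (conj_nonneg hρ hR)).trans (le_of_eq ?_)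
    rw [Matrix.one_mul, Matrix.trace_mul_comm, ← Matrix.mul_assoc]
    congr 3
    rw [Matrix.mul_sub, Matrix.mul_one, Matrix.sub_mul, hQ1, Matrix.one_mul, sub_self, sub_zero]
  -- Parallelogram identity: with E = 1 - Q, the two conjugations are by 1 + E and 1 - E, and their
  -- cross terms cancel.
  have h3 : P * ((2 - Q) * ρ * (2 - Q)) + P * (Q * ρ * Q)
      = (2 : ℂ) • (P * ρ) + (2 : ℂ) • (P * ((1 - Q) * ρ * (1 - Q))) := by
    simp only [two_smul]
    noncomm_ring
  have h4 := congrArg (fun M => (Matrix.trace M).re) h3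
  simp only [Matrix.trace_add, Matrix.trace_smul, Complex.add_re, smul_eq_mul, Complex.mul_re,
    Complex.re_ofNat, Complex.im_ofNat, zero_mul, sub_zero] at h4
  linarith

open scoped Matrix.Norms.L2Operator in
theorem psdSqrt_mono {A B : Matrix n n ℂ} (hA : 0 ≤ A) (h : A ≤ B) : psdSqrt A ≤ psdSqrt B := by
  have h1 : ∀ C : Matrix n n ℂ, 0 ≤ C → CFC.sqrt C = psdSqrt C := fun C hC =>
    (CFC.sqrt_eq_iff C (psdSqrt C) hC (psdSqrt_nonneg C)).2 (psdSqrt_mul_psdSqrt hC)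
  rw [← h1 A hA, ← h1 B (hA.trans h)]
  exact CFC.sqrt_le_sqrt A B h

open scoped Matrix.Norms.L2Operator in
/-- A projector below `A` is below the square root of `A`. -/
theorem projector_le_psdSqrt {P A : Matrix n n ℂ} (hP : 0 ≤ P) (hP1 : P * P = P) (h : P ≤ A) :
    P ≤ psdSqrt A := by
  have h1 : psdSqrt P = P := by
    rw [← (CFC.sqrt_eq_iff P (psdSqrt P) hP (psdSqrt_nonneg P)).2 (psdSqrt_mul_psdSqrt hP)]
    exact (CFC.sqrt_eq_iff P P hP hP).2 hP1
  exact h1 ▸ psdSqrt_mono hP h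

/-- The **Hayashi–Nagaoka inequality** for a projector `P ≤ C`. -/
theorem hayashi_nagaoka {P C : Matrix n n ℂ} (hP : 0 ≤ P) (hP1 : P * P = P) (h : P ≤ C) :
    1 - pinvSqrt C * P * pinvSqrt C ≤ (2 : ℕ) • (1 - P) + (4 : ℕ) • (C - P) := by
  have hC : 0 ≤ C := hP.trans h
  set W := pinvSqrt C with hW
  have hWh : W.IsHermitian := pinvSqrt_isHermitian C
  have hW1 : (W - 1).IsHermitian := hWh.sub isHermitian_one
  have hW2 : (W - 2).IsHermitian := by
    have : (W - 2) = (W - 1) - 1 := by rw [← one_add_one_eq_two]; abel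
    rw [this]; exact hW1.sub isHermitian_one
  have h1 := conj_nonneg (sub_nonneg.2 h) hW2
  have h2 := conj_nonneg hP hW1
  have h3 := sub_nonneg.2 (supportProj_le_one C)
  have h4 := sub_nonneg.2 (projector_le_psdSqrt hP hP1 h)
  have e1 : W * C * W = supportProj C := pinvSqrt_conj_self hC
  have e2 : W * C = psdSqrt C := pinvSqrt_mul_self hC
  have e3 : C * W = psdSqrt C := by
    have := congrArg conjTranspose e2
    rwa [conjTranspose_mul, hWh.eq, (nonneg_iff_posSemidef.1 hC).1.eq,
      (nonneg_iff_posSemidef.1 (psdSqrt_nonneg C)).1.eq] at this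
  -- The defect is an explicit sum of four positive terms. The only one that is not a conjugation or
  -- the complement of a projector, √C - P, is positive because the square root is operator monotone
  -- and fixes P.
  have key : (2 : ℕ) • (1 - P) + (4 : ℕ) • (C - P) - (1 - W * P * W)
      = (W - 2) * (C - P) * (W - 2) + (2 : ℕ) • ((W - 1) * P * (W - 1)) + (1 - supportProj C)
        + (4 : ℕ) • (psdSqrt C - P) := by
    rw [← e1]
    have e4 : (4 : ℕ) • (psdSqrt C - P) = (2 : ℕ) • (W * C) + (2 : ℕ) • (C * W) - (4 : ℕ) • P := by
      rw [e2, e3]; noncomm_ring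
    rw [e4]
    noncomm_ring
  rw [← sub_nonneg, key]
  exact add_nonneg (add_nonneg (add_nonneg h1 (nsmul_nonneg h2 2)) h3) (nsmul_nonneg h4 4)


end FunctionalCalculus

/-! ### Error of one measurement on a projected state. -/

section TraceError
open scoped MatrixOrder

variable {n : Type*} [Fintype n] [DecidableEq n]

/-- The error probability of `T` on a projected state, for `T` bounded below in the
Hayashi–Nagaoka form. -/
theorem one_sub_trace_le_of_hayashi_nagaoka {T P J Q ρ : Matrix n n ℂ}
    (h : 1 - T ≤ (2 : ℕ) • (1 - P) + (4 : ℕ) • J) (hP : 0 ≤ P) (hP1 : P ≤ 1)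
    (hQ : 0 ≤ Q) (hQQ : Q * Q = Q) (hρ : 0 ≤ ρ) (hρ1 : ρ.trace = 1) :
    1 - (T * (Q * ρ * Q)).trace.re
      ≤ 5 * ((1 - Q) * ρ).trace.re + 4 * ((1 - P) * ρ).trace.re
        + 4 * (J * (Q * ρ * Q)).trace.re := by
  have h3 := trace_mul_re_mono h (conj_nonneg hρ (nonneg_iff_posSemidef.1 hQ).1)
  have h4 := trace_conj_projector_le (sub_nonneg.2 hP1) hQ hQQ (sub_le_self 1 hP) hρ
  have h5 : (Q * ρ * Q).trace.re = (Q * ρ).trace.re := by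
    rw [Matrix.trace_mul_comm, ← Matrix.mul_assoc, hQQ]
  have h7 : ((1 - Q) * ρ).trace.re = 1 - (Q * ρ).trace.re := by
    rw [Matrix.sub_mul, Matrix.one_mul, Matrix.trace_sub, Complex.sub_re, hρ1, Complex.one_re]
  -- The weight of 1 - Q is counted once for the trace lost in projecting and 2 · 2 times through
  -- `h4`, hence the constant 5.
  rw [Matrix.sub_mul, Matrix.one_mul, Matrix.trace_sub, Complex.sub_re, h5, Matrix.add_mul,
    Matrix.trace_add, Complex.add_re, smul_mul_assoc, smul_mul_assoc, Matrix.trace_smul,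
    Matrix.trace_smul, Complex.re_nsmul, Complex.re_nsmul] at h3
  simp only [nsmul_eq_mul, Nat.cast_ofNat] at h3
  linarith

end TraceError

/-! ### Gentle measurements and their composition, in the Frobenius norm. -/

section Frobenius
open scoped MatrixOrder Matrix.Norms.Frobenius

variable {n : Type*} [Fintype n] [DecidableEq n]

theorem frobenius_norm_sq (A : Matrix n n ℂ) : ‖A‖ ^ 2 = (A * Aᴴ).trace.re := by
  have h0 : (0 : ℝ) ≤ ∑ i, ∑ j, ‖A i j‖ ^ (2 : ℝ) :=
    Finset.sum_nonneg fun i _ => Finset.sum_nonneg fun j _ => by positivity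
  rw [frobenius_norm_def, ← Real.sqrt_eq_rpow, Real.sq_sqrt h0]
  simp only [Matrix.trace, Matrix.diag_apply, Matrix.mul_apply, Complex.re_sum,
    Matrix.conjTranspose_apply, Complex.star_def, Complex.mul_conj, Complex.ofReal_re,
    Complex.normSq_eq_norm_sq, Real.rpow_two]

theorem frobenius_norm_hermitian_mul_sq {D : Matrix n n ℂ} (hD : D.IsHermitian)
    (v : Matrix n n ℂ) : ‖D * v‖ ^ 2 = (D * D * (v * vᴴ)).trace.re := by
  have h : (D * v) * (D * v)ᴴ = (D * (v * vᴴ)) * D := by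
    rw [conjTranspose_mul, hD.eq]; simp only [Matrix.mul_assoc]
  rw [frobenius_norm_sq, h, Matrix.trace_mul_comm, Matrix.mul_assoc D D]

theorem frobenius_norm_psdSqrt_mul_le {T : Matrix n n ℂ} (hT : 0 ≤ T) (hT1 : T ≤ 1)
    (v : Matrix n n ℂ) : ‖psdSqrt T * v‖ ≤ ‖v‖ := by
  rw [← sq_le_sq₀ (norm_nonneg _) (norm_nonneg _)]
  rw [frobenius_norm_hermitian_mul_sq (psdSqrt_isHermitian T), psdSqrt_mul_psdSqrt hT,
    frobenius_norm_sq]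
  exact (trace_mul_re_mono hT1 (mul_conjTranspose_nonneg v)).trans (by rw [Matrix.one_mul])

theorem le_psdSqrt_of_le_one {T : Matrix n n ℂ} (hT : 0 ≤ T) (hT1 : T ≤ 1) : T ≤ psdSqrt T := by
  have hs : IsSelfAdjoint T := (nonneg_iff_posSemidef.1 hT).1
  have h1 : ∀ t ∈ spectrum ℝ T, t ≤ 1 := by
    have := (le_algebraMap_iff_spectrum_le (R := ℝ) (r := (1 : ℝ)) (a := T)
      (ha := hs)).1 (by simpa using hT1)
    exact this
  conv_lhs => rw [← cfc_id ℝ T hs]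
  refine cfc_mono (fun t ht => ?_) (T.finite_real_spectrum.continuousOn _)
    (T.finite_real_spectrum.continuousOn _)
  have h2 : t ^ 2 ≤ t := by nlinarith [h1 t ht, spectrum_nonneg hT ht]
  exact Real.le_sqrt_of_sq_le h2

/-- An operator that accepts `v` with high probability disturbs it little. -/
theorem frobenius_norm_psdSqrt_mul_sub_sq_le {T : Matrix n n ℂ} (hT : 0 ≤ T) (hT1 : T ≤ 1)
    (v : Matrix n n ℂ) :
    ‖psdSqrt T * v - v‖ ^ 2 ≤ (v * vᴴ).trace.re - (T * (v * vᴴ)).trace.re := by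
  have hD : (psdSqrt T - 1).IsHermitian := (psdSqrt_isHermitian T).sub isHermitian_one
  have e : psdSqrt T * v - v = (psdSqrt T - 1) * v := by rw [Matrix.sub_mul, Matrix.one_mul]
  rw [e, frobenius_norm_hermitian_mul_sq hD, ← Complex.sub_re, ← Matrix.trace_sub]
  -- The difference of the two sides is 2(√T - T), and T ≤ √T on [0, 1].
  have h : (psdSqrt T - 1) * (psdSqrt T - 1) ≤ 1 - T := by
    have e2 : (1 - T) - (psdSqrt T - 1) * (psdSqrt T - 1) = (2 : ℕ) • (psdSqrt T - T) := by
      rw [Matrix.sub_mul, Matrix.mul_sub, psdSqrt_mul_psdSqrt hT]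
      noncomm_ring
    rw [← sub_nonneg, e2]
    exact nsmul_nonneg (sub_nonneg.2 (le_psdSqrt_of_le_one hT hT1)) 2
  refine (trace_mul_re_mono h (mul_conjTranspose_nonneg v)).trans (le_of_eq ?_)
  rw [Matrix.sub_mul, Matrix.one_mul]

/-- Telescoping: peel off the operator that acts first; the later ones contract the displacement it
causes. Every displacement is therefore measured on the undisturbed `v`, never on the output of
earlier steps. -/
theorem frobenius_norm_list_prod_mul (L : List (Matrix n n ℂ))
    (hL : ∀ A ∈ L, ∀ v : Matrix n n ℂ, ‖A * v‖ ≤ ‖v‖) (v : Matrix n n ℂ) :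
    ‖L.reverse.prod * v‖ ≤ ‖v‖ ∧
      ‖L.reverse.prod * v - v‖ ≤ (L.map fun A => ‖A * v - v‖).sum := by
  induction L generalizing v with
  | nil => simp
  | cons A L ih =>
    have ih' := ih (fun B hB => hL B (List.mem_cons_of_mem _ hB))
    simp only [List.reverse_cons, List.prod_append, List.prod_singleton, List.map_cons,
      List.sum_cons, Matrix.mul_assoc]
    refine ⟨(ih' _).1.trans (hL A List.mem_cons_self v), ?_⟩
    have e : L.reverse.prod * (A * v) - v
        = L.reverse.prod * (A * v - v) + (L.reverse.prod * v - v) := by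
      rw [Matrix.mul_sub]; abel
    rw [e]
    exact (norm_add_le _ _).trans (add_le_add (ih' _).1 (ih' v).2)

theorem psdSqrt_mul_conjTranspose {ρ : Matrix n n ℂ} (hρ : 0 ≤ ρ) :
    psdSqrt ρ * (psdSqrt ρ)ᴴ = ρ := by
  rw [(psdSqrt_isHermitian ρ).eq, psdSqrt_mul_psdSqrt hρ]

theorem frobenius_norm_psdSqrt_eq_one {ρ : Matrix n n ℂ} (hρ : 0 ≤ ρ) (hρ1 : ρ.trace = 1) :
    ‖psdSqrt ρ‖ = 1 := by
  rw [← sq_eq_sq₀ (norm_nonneg _) zero_le_one, frobenius_norm_sq, psdSqrt_mul_conjTranspose hρ,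
    hρ1]
  simp

/-- √ρ plays the part of a purification: mixed states are handled like vectors, and probabilities
become squared norms. -/
theorem trace_nestedElement_mul {m : ℕ} (T : Fin m → Matrix n n ℂ) {ρ : Matrix n n ℂ}
    (hρ : 0 ≤ ρ) : (nestedElement T * ρ).trace.re
      = ‖(List.ofFn fun u => psdSqrt (T u)).reverse.prod * psdSqrt ρ‖ ^ 2 := by
  set A := (List.ofFn fun u => psdSqrt (T u)).reverse.prod with hA
  have h : A * psdSqrt ρ * (A * psdSqrt ρ)ᴴ = A * (ρ * Aᴴ) := by
    conv_rhs => rw [← psdSqrt_mul_conjTranspose hρ]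
    rw [conjTranspose_mul]; simp only [Matrix.mul_assoc]
  rw [frobenius_norm_sq, h, Matrix.trace_mul_comm A, Matrix.mul_assoc, Matrix.trace_mul_comm ρ]
  rfl

theorem frobenius_norm_mul_le_of_mem_ofFn {m : ℕ} {T : Fin m → Matrix n n ℂ}
    (hT : ∀ u, 0 ≤ T u) (hT1 : ∀ u, T u ≤ 1) :
    ∀ B ∈ List.ofFn (fun u => psdSqrt (T u)), ∀ v : Matrix n n ℂ, ‖B * v‖ ≤ ‖v‖ := by
  intro B hB v
  obtain ⟨u, rfl⟩ := (List.mem_ofFn' _ _).1 hB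
  exact frobenius_norm_psdSqrt_mul_le (hT u) (hT1 u) v

/-- Success of a nested measurement on a state that every step nearly accepts after projection. -/
theorem one_sub_le_trace_nestedElement {m : ℕ} {T : Fin m → Matrix n n ℂ}
    (hT : ∀ u, 0 ≤ T u) (hT1 : ∀ u, T u ≤ 1) {Q ρ : Matrix n n ℂ} (hQ : 0 ≤ Q) (hQ1 : Q * Q = Q)
    (hρ : 0 ≤ ρ) (hρ1 : ρ.trace = 1) :
    1 - 2 * (2 * √(((1 - Q) * ρ).trace.re)
        + ∑ u, √((Q * ρ * Q).trace.re - (T u * (Q * ρ * Q)).trace.re))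
      ≤ (nestedElement T * ρ).trace.re := by
  set w := psdSqrt ρ with hw
  have hQh : Q.IsHermitian := (nonneg_iff_posSemidef.1 hQ).1
  have hww : w * wᴴ = ρ := psdSqrt_mul_conjTranspose hρ
  have hvv : Q * w * (Q * w)ᴴ = Q * ρ * Q := by
    rw [conjTranspose_mul, hQh.eq, ← hww]; simp only [Matrix.mul_assoc]
  have hw1 : ‖w‖ = 1 := frobenius_norm_psdSqrt_eq_one hρ hρ1
  set A := (List.ofFn fun u => psdSqrt (T u)).reverse.prod with hA
  have hL := frobenius_norm_mul_le_of_mem_ofFn hT hT1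
  have h1 : ‖w - Q * w‖ = √(((1 - Q) * ρ).trace.re) := by
    have hR : (1 - Q).IsHermitian := isHermitian_one.sub hQh
    have e : w - Q * w = (1 - Q) * w := by rw [Matrix.sub_mul, Matrix.one_mul]
    have e2 : (1 - Q) * (1 - Q) = 1 - Q := by
      rw [Matrix.mul_sub, Matrix.mul_one, Matrix.sub_mul, hQ1, Matrix.one_mul, sub_self, sub_zero]
    rw [← Real.sqrt_sq (norm_nonneg (w - Q * w)), e, frobenius_norm_hermitian_mul_sq hR, hww, e2]
  have h2 := (frobenius_norm_list_prod_mul _ hL (Q * w)).2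
  rw [List.map_ofFn, List.sum_ofFn] at h2
  have h3 : ∀ u, ‖psdSqrt (T u) * (Q * w) - Q * w‖
      ≤ √((Q * ρ * Q).trace.re - (T u * (Q * ρ * Q)).trace.re) := by
    intro u
    refine Real.le_sqrt_of_sq_le ?_
    have := frobenius_norm_psdSqrt_mul_sub_sq_le (hT u) (hT1 u) (Q * w)
    rwa [hvv] at this
  have h4 : ‖A * (Q * w) - Q * w‖
      ≤ ∑ u, √((Q * ρ * Q).trace.re - (T u * (Q * ρ * Q)).trace.re) :=
    h2.trans (Finset.sum_le_sum fun u _ => h3 u)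
  have h5 : ‖A * (w - Q * w)‖ ≤ ‖w - Q * w‖ := (frobenius_norm_list_prod_mul _ hL _).1
  -- The projection error w - Qw enters twice, before and after `A`, which explains the factor 2 on
  -- its square root.
  have e : w = A * w - (A * (w - Q * w) + (A * (Q * w) - Q * w) - (w - Q * w)) := by
    rw [Matrix.mul_sub]; abel
  have h6 : ‖w‖ ≤ ‖A * w‖ + (‖A * (w - Q * w)‖ + ‖A * (Q * w) - Q * w‖ + ‖w - Q * w‖) := by
    conv_lhs => rw [e]
    refine (norm_sub_le _ _).trans (add_le_add le_rfl ((norm_sub_le _ _).trans ?_))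
    exact add_le_add (norm_add_le _ _) le_rfl
  rw [trace_nestedElement_mul T hρ]
  -- x² ≥ 2x - 1 turns the lower bound on the norm into one on its square.
  nlinarith [sq_nonneg (‖A * w‖ - 1)]

theorem trace_nestedElement_le {m : ℕ} {T : Fin m → Matrix n n ℂ}
    (hT : ∀ u, 0 ≤ T u) (hT1 : ∀ u, T u ≤ 1) {ρ : Matrix n n ℂ}
    (hρ : 0 ≤ ρ) (hρ1 : ρ.trace = 1) : (nestedElement T * ρ).trace.re ≤ 1 := by
  rw [trace_nestedElement_mul T hρ]
  refine pow_le_one₀ (norm_nonneg _) ?_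
  rw [← frobenius_norm_psdSqrt_eq_one hρ hρ1]
  exact (frobenius_norm_list_prod_mul _ (frobenius_norm_mul_le_of_mem_ofFn hT hT1) _).1

end Frobenius

end Matrix

/-! ### Algebra of tensor products. -/

section Tensor

variable {d : Type*} {N : ℕ}

theorem tensorMatrix_mul [Fintype d] (A B : Fin N → Matrix d d ℂ) :
    tensorMatrix A * tensorMatrix B = tensorMatrix fun n => A n * B n := by
  classical
  ext i j
  simp only [tensorMatrix, Matrix.mul_apply, Matrix.of_apply, ← Finset.prod_mul_distrib]
  rw [Finset.prod_univ_sum, Fintype.piFinset_univ]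

theorem tensorMatrix_conjTranspose (A : Fin N → Matrix d d ℂ) :
    (tensorMatrix A)ᴴ = tensorMatrix fun n => (A n)ᴴ := by
  ext i j
  simp [tensorMatrix, Matrix.conjTranspose_apply]

theorem tensorMatrix_diagonal [DecidableEq d] (f : Fin N → d → ℂ) :
    tensorMatrix (fun n => Matrix.diagonal (f n)) = Matrix.diagonal fun j => ∏ n, f n (j n) := by
  ext i j
  simp only [tensorMatrix, Matrix.of_apply, Matrix.diagonal_apply]
  split_ifs with h
  · subst h; simp
  · obtain ⟨n, hn⟩ := Function.ne_iff.1 h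
    exact Finset.prod_eq_zero (Finset.mem_univ n) (if_neg hn)

theorem tensorMatrix_one [DecidableEq d] :
    tensorMatrix (fun _ : Fin N => (1 : Matrix d d ℂ)) = 1 := by
  have h := tensorMatrix_diagonal (d := d) (N := N) fun _ _ => 1
  simpa using h

theorem tensorMatrix_trace [Fintype d] (A : Fin N → Matrix d d ℂ) :
    (tensorMatrix A).trace = ∏ n, (A n).trace := by
  classical
  simp only [Matrix.trace, tensorMatrix, Matrix.diag_apply, Matrix.of_apply]
  rw [Finset.prod_univ_sum, Fintype.piFinset_univ]

/-- Distributivity; it is what makes a random codeword state average to ρ^{⊗N}. -/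
theorem sum_tensorMatrix {X : Type*} [Fintype X] (p : X → ℂ) (σ : X → Matrix d d ℂ) :
    ∑ x : Fin N → X, (∏ n, p (x n)) • tensorMatrix (fun n => σ (x n))
      = tensorMatrix fun _ => ∑ x, p x • σ x := by
  classical
  ext i j
  simp only [Matrix.sum_apply, tensorMatrix, Matrix.smul_apply, Matrix.of_apply, smul_eq_mul,
    ← Finset.prod_mul_distrib]
  rw [Finset.prod_univ_sum, Fintype.piFinset_univ]

end Tensor

/-! ### Product eigenbases and typical projectors. -/

section Spectral
open scoped MatrixOrder

variable {d : Type*} [Fintype d] [DecidableEq d] {N : ℕ} {A : Fin N → Matrix d d ℂ}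

/-- The unitary whose columns are the product eigenvectors. -/
def eigenSequenceUnitary (hA : ∀ n, (A n).IsHermitian) : Matrix (Fin N → d) (Fin N → d) ℂ :=
  tensorMatrix fun n => ((hA n).eigenvectorUnitary : Matrix d d ℂ)

/-- The operator that is diagonal in the product eigenbasis, with the given eigenvalues. -/
def spectralOperator (hA : ∀ n, (A n).IsHermitian) (f : (Fin N → d) → ℝ) :
    Matrix (Fin N → d) (Fin N → d) ℂ :=
  eigenSequenceUnitary hA * Matrix.diagonal (fun j => (f j : ℂ)) * (eigenSequenceUnitary hA)ᴴ

variable (hA : ∀ n, (A n).IsHermitian)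

theorem eigenSequenceUnitary_mul_conjTranspose :
    eigenSequenceUnitary hA * (eigenSequenceUnitary hA)ᴴ = 1 := by
  rw [eigenSequenceUnitary, tensorMatrix_conjTranspose, tensorMatrix_mul, ← tensorMatrix_one]
  congr 1
  funext n
  exact Unitary.coe_mul_star_self (hA n).eigenvectorUnitary

theorem eigenSequenceUnitary_conjTranspose_mul :
    (eigenSequenceUnitary hA)ᴴ * eigenSequenceUnitary hA = 1 := by
  rw [eigenSequenceUnitary, tensorMatrix_conjTranspose, tensorMatrix_mul, ← tensorMatrix_one]
  congr 1
  funext n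
  exact Unitary.coe_star_mul_self (hA n).eigenvectorUnitary

theorem spectralOperator_mul (f g : (Fin N → d) → ℝ) :
    spectralOperator hA f * spectralOperator hA g = spectralOperator hA fun j => f j * g j := by
  have h : ∀ D E : Matrix (Fin N → d) (Fin N → d) ℂ,
      (eigenSequenceUnitary hA * D * (eigenSequenceUnitary hA)ᴴ)
        * (eigenSequenceUnitary hA * E * (eigenSequenceUnitary hA)ᴴ)
      = eigenSequenceUnitary hA * (D * E) * (eigenSequenceUnitary hA)ᴴ := by
    intro D E
    calc _ = eigenSequenceUnitary hA * D
          * ((eigenSequenceUnitary hA)ᴴ * eigenSequenceUnitary hA) * E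
          * (eigenSequenceUnitary hA)ᴴ := by simp only [Matrix.mul_assoc]
      _ = _ := by
        rw [eigenSequenceUnitary_conjTranspose_mul]; simp only [Matrix.mul_assoc, Matrix.one_mul]
  rw [spectralOperator, spectralOperator, h, Matrix.diagonal_mul_diagonal, spectralOperator]
  simp only [Complex.ofReal_mul]

theorem spectralOperator_one : spectralOperator hA (fun _ => 1) = 1 := by
  simp [spectralOperator, eigenSequenceUnitary_mul_conjTranspose]

theorem spectralOperator_sub (f g : (Fin N → d) → ℝ) :
    spectralOperator hA f - spectralOperator hA g = spectralOperator hA fun j => f j - g j := by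
  simp only [spectralOperator, Complex.ofReal_sub]
  rw [← Matrix.sub_mul, ← Matrix.mul_sub, Matrix.diagonal_sub]

theorem spectralOperator_const (r : ℝ) : spectralOperator hA (fun _ => r) = (r : ℂ) • 1 := by
  rw [spectralOperator, ← eigenSequenceUnitary_mul_conjTranspose hA, ← Matrix.smul_one_eq_diagonal]
  simp

theorem spectralOperator_nonneg {f : (Fin N → d) → ℝ} (hf : ∀ j, 0 ≤ f j) :
    0 ≤ spectralOperator hA f :=
  Matrix.nonneg_iff_posSemidef.2 ((Matrix.PosSemidef.diagonal fun j =>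
    Complex.zero_le_real.2 (hf j)).mul_mul_conjTranspose_same _)

theorem spectralOperator_mono {f g : (Fin N → d) → ℝ} (h : ∀ j, f j ≤ g j) :
    spectralOperator hA f ≤ spectralOperator hA g := by
  rw [← sub_nonneg, spectralOperator_sub]
  exact spectralOperator_nonneg hA fun j => sub_nonneg.2 (h j)

theorem spectralOperator_trace (f : (Fin N → d) → ℝ) :
    (spectralOperator hA f).trace.re = ∑ j, f j := by
  rw [spectralOperator, Matrix.trace_mul_comm, ← Matrix.mul_assoc,
    eigenSequenceUnitary_conjTranspose_mul, Matrix.one_mul, Matrix.trace_diagonal, Complex.re_sum]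
  simp

/-- The eigenvalue of the product state at a product eigenvector. -/
def eigenWeight (j : Fin N → d) : ℝ := ∏ n, (hA n).eigenvalues (j n)

theorem tensorMatrix_eq_spectralOperator :
    tensorMatrix A = spectralOperator hA (eigenWeight hA) := by
  have h : ∀ n, A n = ((hA n).eigenvectorUnitary : Matrix d d ℂ)
      * Matrix.diagonal (fun j => ((hA n).eigenvalues j : ℂ))
      * ((hA n).eigenvectorUnitary : Matrix d d ℂ)ᴴ := by
    intro n
    conv_lhs => rw [(hA n).spectral_theorem, Unitary.conjStarAlgAut_apply]
    rfl
  conv_lhs => rw [funext h]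
  rw [← tensorMatrix_mul, ← tensorMatrix_mul, tensorMatrix_diagonal, ← tensorMatrix_conjTranspose]
  simp only [spectralOperator, eigenSequenceUnitary, eigenWeight, Complex.ofReal_prod]

variable (h δ : ℝ)

open Classical in
-- Projector and product state are diagonal in the same basis, so operator estimates reduce to
-- pointwise ones on eigenvalue sequences.
theorem typicalProjector_eq_spectralOperator :
    typicalProjector hA h δ
      = spectralOperator hA fun j => if IsTypicalSequence hA h δ j then 1 else 0 := by
  ext a b
  rw [typicalProjector, spectralOperator, Matrix.sum_apply, Matrix.mul_apply, Finset.sum_filter]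
  simp only [Matrix.mul_diagonal]
  refine Finset.sum_congr rfl fun j _ => ?_
  split_ifs with hj
  · simp [Matrix.vecMulVec_apply, eigenSequence, eigenSequenceUnitary, tensorMatrix,
      Matrix.IsHermitian.eigenvectorUnitary_apply]
  · simp

theorem typicalProjector_nonneg : 0 ≤ typicalProjector hA h δ := by
  classical
  rw [typicalProjector_eq_spectralOperator]
  exact spectralOperator_nonneg hA fun j => by split_ifs <;> norm_num

theorem typicalProjector_le_one : typicalProjector hA h δ ≤ 1 := by
  classical
  rw [typicalProjector_eq_spectralOperator, ← spectralOperator_one hA]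
  exact spectralOperator_mono hA fun j => by split_ifs <;> norm_num

theorem typicalProjector_mul_self :
    typicalProjector hA h δ * typicalProjector hA h δ = typicalProjector hA h δ := by
  classical
  rw [typicalProjector_eq_spectralOperator, spectralOperator_mul]
  congr 1; funext j; split_ifs <;> norm_num

open Classical in
theorem trace_one_sub_typicalProjector_mul :
    ((1 - typicalProjector hA h δ) * tensorMatrix A).trace.re
      = ∑ j with ¬ IsTypicalSequence hA h δ j, eigenWeight hA j := by
  rw [typicalProjector_eq_spectralOperator, ← spectralOperator_one hA, spectralOperator_sub,
    tensorMatrix_eq_spectralOperator hA, spectralOperator_mul, spectralOperator_trace,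
    Finset.sum_filter]
  refine Finset.sum_congr rfl fun j _ => ?_
  split_ifs <;> simp_all

variable {hA h δ}

theorem IsTypicalSequence.abs_sum_logb_le {j : Fin N → d} (hj : IsTypicalSequence hA h δ j) :
    |∑ n, Real.logb 2 ((hA n).eigenvalues (j n)) + N * h| ≤ N * δ := by
  -- At N = 0 both sides vanish, so the convention 1 / 0 = 0 does no harm.
  rcases Nat.eq_zero_or_pos N with rfl | hN
  · simp
  · have hN' : (0 : ℝ) < N := Nat.cast_pos.2 hN
    have e : ∑ n, Real.logb 2 ((hA n).eigenvalues (j n)) + N * h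
        = -(N * (-(1 / (N : ℝ)) * ∑ n, Real.logb 2 ((hA n).eigenvalues (j n)) - h)) := by
      field_simp; ring
    rw [e, abs_neg, abs_mul, abs_of_pos hN']
    exact mul_le_mul_of_nonneg_left hj.2 hN'.le

/-- Positivity of the eigenvalues is essential, since `Real.logb` is 0 at 0. -/
theorem IsTypicalSequence.eigenWeight_eq {j : Fin N → d} (hj : IsTypicalSequence hA h δ j) :
    eigenWeight hA j = (2 : ℝ) ^ ∑ n, Real.logb 2 ((hA n).eigenvalues (j n)) := by
  rw [Real.rpow_sum_of_pos two_pos]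
  exact Finset.prod_congr rfl fun n _ =>
    (Real.rpow_logb two_pos (by norm_num) (hj.1 n)).symm

theorem IsTypicalSequence.le_eigenWeight {j : Fin N → d} (hj : IsTypicalSequence hA h δ j) :
    (2 : ℝ) ^ (-(N * (h + δ))) ≤ eigenWeight hA j := by
  rw [hj.eigenWeight_eq]
  refine Real.rpow_le_rpow_of_exponent_le one_le_two ?_
  linarith [(abs_le.1 hj.abs_sum_logb_le).1]

theorem IsTypicalSequence.eigenWeight_le {j : Fin N → d} (hj : IsTypicalSequence hA h δ j) :
    eigenWeight hA j ≤ (2 : ℝ) ^ (-(N * (h - δ))) := by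
  rw [hj.eigenWeight_eq]
  refine Real.rpow_le_rpow_of_exponent_le one_le_two ?_
  linarith [(abs_le.1 hj.abs_sum_logb_le).2]

variable (hA h δ)

theorem eigenWeight_nonneg (hpos : ∀ n, (A n).PosSemidef) (j : Fin N → d) :
    0 ≤ eigenWeight hA j :=
  Finset.prod_nonneg fun n _ => (hpos n).eigenvalues_nonneg _

theorem tensorMatrix_nonneg (hpos : ∀ n, (A n).PosSemidef) : 0 ≤ tensorMatrix A := by
  rw [tensorMatrix_eq_spectralOperator fun n => (hpos n).1]
  exact spectralOperator_nonneg _ fun j => eigenWeight_nonneg _ hpos j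

/-- Counting: the weights sum to 1, and each typical one is at least 2^{-N(h+δ)}. -/
theorem trace_typicalProjector_le (hpos : ∀ n, (A n).PosSemidef) (htr : ∀ n, (A n).trace = 1) :
    (typicalProjector hA h δ).trace.re ≤ (2 : ℝ) ^ (N * (h + δ)) := by
  classical
  have h1 : ∑ j, eigenWeight hA j = 1 := by
    rw [← spectralOperator_trace hA, ← tensorMatrix_eq_spectralOperator hA, tensorMatrix_trace]
    simp [htr]
  rw [typicalProjector_eq_spectralOperator, spectralOperator_trace]
  refine le_of_le_of_eq ?_ (mul_one ((2 : ℝ) ^ _))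
  rw [← h1, Finset.mul_sum]
  refine Finset.sum_le_sum fun j _ => ?_
  split_ifs with hj
  · have := mul_le_mul_of_nonneg_left hj.le_eigenWeight
      (Real.rpow_nonneg zero_le_two (N * (h + δ)))
    rw [h1]
    rwa [← Real.rpow_add two_pos, add_neg_cancel, Real.rpow_zero] at this
  · exact mul_nonneg (Real.rpow_nonneg zero_le_two _) (eigenWeight_nonneg hA hpos j)

theorem typicalProjector_conj_tensorMatrix_le :
    typicalProjector hA h δ * tensorMatrix A * typicalProjector hA h δ
      ≤ (((2 : ℝ) ^ (-(N * (h - δ))) : ℝ) : ℂ) • 1 := by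
  classical
  rw [typicalProjector_eq_spectralOperator, tensorMatrix_eq_spectralOperator hA,
    spectralOperator_mul, spectralOperator_mul, ← spectralOperator_const hA]
  refine spectralOperator_mono hA fun j => ?_
  split_ifs with hj
  · simpa using hj.eigenWeight_le
  · simpa using Real.rpow_nonneg zero_le_two _

end Spectral

/-! ### Chernoff bounds on a finite alphabet. -/

section Tail

variable {α : Type*} [Fintype α]

theorem sum_prod_pow (q : α → ℝ) (N : ℕ) :
    ∑ a : Fin N → α, ∏ n, q (a n) = (∑ a, q a) ^ N := by
  classical
  rw [← Fintype.piFinset_univ, ← Finset.prod_univ_sum]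
  simp

/-- The variable g - δ has mean -δ < 0, so for small t the first-order term pulls its exponential
moment below 1; the estimate is e^x ≤ 1 + x + x² for |x| ≤ 1. -/
theorem exists_exp_moment_lt_one {q : α → ℝ} (hq : ∀ a, 0 ≤ q a) (hq1 : ∑ a, q a = 1)
    {g : α → ℝ} (hg : ∑ a, q a * g a = 0) {δ : ℝ} (hδ : 0 < δ) :
    ∃ t c : ℝ, 0 < t ∧ 0 < c ∧ c < 1 ∧ ∑ a, q a * Real.exp (t * (g a - δ)) ≤ c := by
  set B := 1 + δ + ∑ a, |g a| with hB
  have hS : 0 ≤ ∑ a, |g a| := Finset.sum_nonneg fun a _ => abs_nonneg _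
  have hBpos : 0 < B := by positivity
  have hδB : δ ≤ B := by linarith
  have hgB : ∀ a, |g a - δ| ≤ B := fun a => by
    have := Finset.single_le_sum (f := fun a => |g a|) (fun a _ => abs_nonneg _)
      (Finset.mem_univ a)
    calc |g a - δ| ≤ |g a| + |δ| := abs_sub _ _
      _ ≤ B := by rw [abs_of_pos hδ]; linarith
  -- For t = r / (2B), the linear gain tδ = r²/2 beats the quadratic loss, at most (r/2)² = r²/4.
  set r := δ / B with hr
  have hr0 : 0 < r := div_pos hδ hBpos
  have hr1 : r ≤ 1 := (div_le_one hBpos).2 hδB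
  set t := r / (2 * B) with ht
  have htB : t * B = r / 2 := by rw [ht]; field_simp
  have htδ : t * δ = r ^ 2 / 2 := by rw [ht, hr]; field_simp
  have ht0 : 0 < t := by positivity
  refine ⟨t, 1 - r ^ 2 / 4, ht0, by nlinarith, by nlinarith, ?_⟩
  have hpt : ∀ a, Real.exp (t * (g a - δ)) ≤ 1 + t * (g a - δ) + (r / 2) ^ 2 := fun a => by
    have h1 : |t * (g a - δ)| ≤ r / 2 := by
      rw [abs_mul, abs_of_pos ht0, ← htB]
      exact mul_le_mul_of_nonneg_left (hgB a) ht0.le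
    have h2 := (abs_le.1 (Real.abs_exp_sub_one_sub_id_le (h1.trans (by linarith)))).2
    have h3 := sq_le_sq' (abs_le.1 h1).1 (abs_le.1 h1).2
    linarith
  calc ∑ a, q a * Real.exp (t * (g a - δ))
      ≤ ∑ a, q a * (1 + t * (g a - δ) + (r / 2) ^ 2) :=
        Finset.sum_le_sum fun a _ => mul_le_mul_of_nonneg_left (hpt a) (hq a)
    _ = ∑ a, ((1 - t * δ + (r / 2) ^ 2) * q a + t * (q a * g a)) :=
        Finset.sum_congr rfl fun a _ => by ring
    _ = 1 - r ^ 2 / 4 := by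
        rw [Finset.sum_add_distrib, ← Finset.mul_sum, ← Finset.mul_sum, hq1, hg, htδ]; ring

theorem sum_prod_mul_exp (q g : α → ℝ) (t δ : ℝ) (N : ℕ) :
    ∑ a : Fin N → α, (∏ n, q (a n)) * Real.exp (t * (∑ n, g (a n) - N * δ))
      = (∑ a, q a * Real.exp (t * (g a - δ))) ^ N := by
  rw [← sum_prod_pow]
  refine Finset.sum_congr rfl fun a _ => ?_
  rw [Finset.prod_mul_distrib, ← Real.exp_sum, ← Finset.mul_sum, Finset.sum_sub_distrib]
  simp

/-- Exponential decay of the two-sided tail of a sum of independent letters. -/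
theorem exists_tail_bound {q : α → ℝ} (hq : ∀ a, 0 ≤ q a) (hq1 : ∑ a, q a = 1)
    {g : α → ℝ} (hg : ∑ a, q a * g a = 0) {δ : ℝ} (hδ : 0 < δ) :
    ∃ c : ℝ, 0 < c ∧ c < 1 ∧ ∀ (N : ℕ) (P : (Fin N → α) → Prop) [DecidablePred P],
      (∀ a, P a → (∀ n, 0 < q (a n)) → N * δ ≤ |∑ n, g (a n)|) →
      ∑ a with P a, ∏ n, q (a n) ≤ 2 * c ^ N := by
  obtain ⟨t, c, ht, hc, hc1, h⟩ := exists_exp_moment_lt_one hq hq1 hg hδ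
  obtain ⟨t', c', ht', hc', hc1', h'⟩ := exists_exp_moment_lt_one hq hq1
    (g := fun a => -g a) (by simp [hg]) hδ
  refine ⟨max c c', lt_max_of_lt_left hc, max_lt hc1 hc1', fun N P _ hP => ?_⟩
  have key : ∑ a with P a, ∏ n, q (a n)
      ≤ ∑ a : Fin N → α, (∏ n, q (a n)) * Real.exp (t * (∑ n, g (a n) - N * δ))
        + ∑ a : Fin N → α, (∏ n, q (a n)) * Real.exp (t' * (∑ n, -g (a n) - N * δ)) := by
    rw [Finset.sum_filter, ← Finset.sum_add_distrib]
    refine Finset.sum_le_sum fun a _ => ?_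
    have hw : 0 ≤ ∏ n, q (a n) := Finset.prod_nonneg fun n _ => hq _
    have h0 : 0 ≤ (∏ n, q (a n)) * Real.exp (t * (∑ n, g (a n) - N * δ)) := by positivity
    have h0' : 0 ≤ (∏ n, q (a n)) * Real.exp (t' * (∑ n, -g (a n) - N * δ)) := by positivity
    split_ifs with ha
    -- Sequences through a letter of weight 0 contribute nothing, so the value of `g` there,
    -- possibly a logarithm of 0, is irrelevant.
    · by_cases hpos : ∀ n, 0 < q (a n)
      · rcases le_abs.1 (hP a ha hpos) with h1 | h1
        · refine le_add_of_le_of_nonneg (le_mul_of_one_le_right hw (Real.one_le_exp ?_)) h0'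
          exact mul_nonneg ht.le (by linarith)
        · refine le_add_of_nonneg_of_le h0 (le_mul_of_one_le_right hw (Real.one_le_exp ?_))
          rw [Finset.sum_neg_distrib]
          exact mul_nonneg ht'.le (by linarith)
      · push Not at hpos
        obtain ⟨n, hn⟩ := hpos
        rw [Finset.prod_eq_zero (Finset.mem_univ n) (le_antisymm hn (hq _))]
        simp
    · exact add_nonneg h0 h0'
  rw [sum_prod_mul_exp q g, sum_prod_mul_exp q (fun a => -g a)] at key
  have hs : ∀ (s δ : ℝ) (g : α → ℝ), 0 ≤ ∑ a, q a * Real.exp (s * (g a - δ)) := fun s δ g =>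
    Finset.sum_nonneg fun a _ => mul_nonneg (hq a) (Real.exp_nonneg _)
  have h1 := pow_le_pow_left₀ (hs t δ g) (h.trans (le_max_left c c')) N
  have h2 := pow_le_pow_left₀ (hs t' δ fun a => -g a) (h'.trans (le_max_right c c')) N
  linarith

end Tail

/-! ### Marginals of families of independent variables. -/

section Marginal

variable {K Y : Type*} [Fintype K] [DecidableEq K] [Fintype Y] {W : Y → ℝ}

theorem sum_prod_mul_apply (hW : ∑ y, W y = 1) (k : K) (f : Y → ℝ) :
    ∑ c : K → Y, (∏ i, W (c i)) * f (c k) = ∑ y, W y * f y := by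
  classical
  have h : ∀ c : K → Y, (∏ i, W (c i)) * f (c k)
      = ∏ i, W (c i) * (if i = k then f (c i) else 1) := fun c => by
    rw [Finset.prod_mul_distrib, Finset.prod_ite_eq' Finset.univ k fun i => f (c i)]
    simp
  rw [Finset.sum_congr rfl fun c _ => h c, ← Fintype.piFinset_univ,
    ← Finset.prod_univ_sum (fun _ => Finset.univ) fun i y => W y * (if i = k then f y else 1),
    Finset.prod_eq_single k (fun i _ hi => by simp [hi, hW]) (by simp)]
  simp

/-- Fixing the value `y` of `c k` by an indicator makes the summand a product over coordinates; all
factors except those of `k` and `k'` then sum to 1. -/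
theorem sum_prod_mul_apply_apply (hW : ∑ y, W y = 1) {k k' : K} (hk : k ≠ k') (F : Y → Y → ℝ) :
    ∑ c : K → Y, (∏ i, W (c i)) * F (c k) (c k') = ∑ y, W y * ∑ z, W z * F y z := by
  classical
  have h : ∀ c : K → Y, (∏ i, W (c i)) * F (c k) (c k') = ∑ y, ∏ i, W (c i)
      * (if i = k then (if c i = y then 1 else 0) else if i = k' then F y (c i) else 1) := by
    intro c
    have h1 : ∀ y, ∏ i, W (c i)
        * (if i = k then (if c i = y then 1 else 0) else if i = k' then F y (c i) else 1)
        = if c k = y then (∏ i, W (c i)) * F (c k) (c k') else 0 := by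
      intro y
      rw [Finset.prod_mul_distrib]
      split_ifs with hy
      · subst hy
        congr 1
        rw [Finset.prod_eq_single_of_mem k' (Finset.mem_univ _) fun i _ hi => ?_]
        · simp [hk.symm]
        · by_cases hik : i = k
          · simp [hik]
          · simp [hik, hi]
      · rw [mul_eq_zero]; right
        exact Finset.prod_eq_zero (Finset.mem_univ k) (by simp [hy])
    rw [Finset.sum_congr rfl fun y _ => h1 y]
    simp
  rw [Finset.sum_congr rfl fun c _ => h c, Finset.sum_comm]
  refine Finset.sum_congr rfl fun y _ => ?_
  rw [← Fintype.piFinset_univ, ← Finset.prod_univ_sum (fun _ => Finset.univ) fun i z => W z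
      * (if i = k then (if z = y then 1 else 0) else if i = k' then F y z else 1),
    ← Finset.mul_prod_erase _ _ (Finset.mem_univ k),
    Finset.prod_eq_single_of_mem k' (by simp [hk.symm])]
  · simp [hk.symm]
  · intro i hi hik
    have : i ≠ k := Finset.ne_of_mem_erase hi
    simp [this, hik, hW]

end Marginal

namespace QuantumSource
open scoped MatrixOrder

variable {X d : Type*} [Fintype X] [Fintype d] (S : QuantumSource X d)

/-! ### Averages over random codes. -/

section Average

variable {N m : ℕ}

/-- The probability of a sequence of independent letters. -/
def seqProb (x : Fin N → X) : ℝ := ∏ n, S.prob (x n)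

theorem seqProb_nonneg (x : Fin N → X) : 0 ≤ S.seqProb x :=
  Finset.prod_nonneg fun _ _ => S.prob_nonneg _

theorem sum_seqProb : ∑ x : Fin N → X, S.seqProb x = 1 := by
  simp only [seqProb]
  rw [sum_prod_pow, S.prob_sum, one_pow]

theorem codeAverage_mono {f g : TreeCode X N m → ℝ} (h : ∀ c, f c ≤ g c) :
    S.codeAverage f ≤ S.codeAverage g :=
  Finset.sum_le_sum fun c _ => mul_le_mul_of_nonneg_left (h c)
    (Finset.prod_nonneg fun k _ => S.seqProb_nonneg (c k))

theorem codeAverage_add (f g : TreeCode X N m → ℝ) :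
    S.codeAverage (fun c => f c + g c) = S.codeAverage f + S.codeAverage g := by
  simp only [codeAverage, mul_add, Finset.sum_add_distrib]

theorem codeAverage_mul_left (r : ℝ) (f : TreeCode X N m → ℝ) :
    S.codeAverage (fun c => r * f c) = r * S.codeAverage f := by
  simp only [codeAverage, Finset.mul_sum, mul_left_comm]

theorem codeAverage_sum {ι : Type*} (s : Finset ι) (f : ι → TreeCode X N m → ℝ) :
    S.codeAverage (fun c => ∑ i ∈ s, f i c) = ∑ i ∈ s, S.codeAverage (f i) := by
  simp only [codeAverage, Finset.mul_sum]
  exact Finset.sum_comm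

theorem codeAverage_const (r : ℝ) : S.codeAverage (fun _ : TreeCode X N m => r) = r := by
  have h : ∑ c : TreeCode X N m, ∏ k, S.seqProb (c k) = 1 := by
    simp only [TreeCode]
    rw [← Fintype.piFinset_univ, ← Finset.prod_univ_sum]
    simp [sum_seqProb]
  rw [codeAverage, ← Finset.sum_mul]
  exact (congrArg (· * r) h).trans (one_mul r)

theorem codeAverage_sub (f g : TreeCode X N m → ℝ) :
    S.codeAverage (fun c => f c - g c) = S.codeAverage f - S.codeAverage g := by
  simp only [codeAverage, mul_sub, Finset.sum_sub_distrib]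

theorem codeAverage_apply (k : Fin m → Bool) (f : (Fin N → X) → ℝ) :
    S.codeAverage (fun c : TreeCode X N m => f (c k)) = ∑ x, S.seqProb x * f x :=
  sum_prod_mul_apply S.sum_seqProb k f

theorem codeAverage_apply_apply {k k' : Fin m → Bool} (hk : k ≠ k')
    (F : (Fin N → X) → (Fin N → X) → ℝ) :
    S.codeAverage (fun c : TreeCode X N m => F (c k) (c k'))
      = ∑ x, S.seqProb x * ∑ z, S.seqProb z * F x z :=
  sum_prod_mul_apply_apply S.sum_seqProb hk F

/-- Jensen for the concave square root, through its tangent at s²: √f ≤ (f + s²) / (2s). -/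
theorem codeAverage_sqrt_le {f : TreeCode X N m → ℝ} (hf : ∀ c, 0 ≤ f c) {s : ℝ} (hs : 0 < s)
    (h : S.codeAverage f ≤ s ^ 2) : S.codeAverage (fun c => √(f c)) ≤ s := by
  have h1 : ∀ c, √(f c) ≤ (2 * s)⁻¹ * (f c + s ^ 2) := fun c => by
    rw [inv_mul_eq_div, le_div_iff₀ (by positivity)]
    nlinarith [sq_nonneg (√(f c) - s), Real.sq_sqrt (hf c)]
  refine (S.codeAverage_mono h1).trans ?_
  rw [codeAverage_mul_left, codeAverage_add, codeAverage_const, inv_mul_eq_div,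
    div_le_iff₀ (by positivity)]
  nlinarith

end Average

variable [DecidableEq d]

/-! ### The operators of the tree and the error of one step. -/

section Operators

variable {N m : ℕ} (δ : ℝ)

theorem codewordState_nonneg (x : Fin N → X) : 0 ≤ S.codewordState x :=
  tensorMatrix_nonneg fun n => S.state_posSemidef (x n)

omit [DecidableEq d] in
theorem codewordState_trace (x : Fin N → X) : (S.codewordState x).trace = 1 := by
  simp [codewordState, tensorMatrix_trace, S.state_trace]

omit [DecidableEq d] in
theorem avgState_posSemidef : S.avgState.PosSemidef :=
  Matrix.posSemidef_sum _ fun x _ =>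
    (S.state_posSemidef x).smul (Complex.zero_le_real.2 (S.prob_nonneg x))

omit [DecidableEq d] in
theorem avgState_trace : S.avgState.trace = 1 := by
  simp only [avgState, Matrix.trace_sum, Matrix.trace_smul, S.state_trace, smul_eq_mul, mul_one]
  exact_mod_cast S.prob_sum

omit [DecidableEq d] in
theorem sum_seqProb_mul_trace (M : Matrix (Fin N → d) (Fin N → d) ℂ) :
    ∑ x, S.seqProb x * (M * S.codewordState x).trace.re
      = (M * tensorMatrix fun _ : Fin N => S.avgState).trace.re := by
  simp only [avgState]
  rw [← sum_tensorMatrix (fun x => (S.prob x : ℂ)) S.state, Matrix.mul_sum, Matrix.trace_sum,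
    Complex.re_sum]
  refine Finset.sum_congr rfl fun x _ => ?_
  rw [Matrix.mul_smul, Matrix.trace_smul, smul_eq_mul, ← Complex.ofReal_prod, Complex.re_ofReal_mul]
  rfl

theorem condTypProj_nonneg (x : Fin N → X) : 0 ≤ S.condTypProj δ x :=
  typicalProjector_nonneg _ _ _

theorem condTypProj_mul_self (x : Fin N → X) :
    S.condTypProj δ x * S.condTypProj δ x = S.condTypProj δ x :=
  typicalProjector_mul_self _ _ _

theorem condTypProj_le_one (x : Fin N → X) : S.condTypProj δ x ≤ 1 :=
  typicalProjector_le_one _ _ _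

theorem typProj_nonneg : 0 ≤ S.typProj N δ := typicalProjector_nonneg _ _ _

theorem typProj_mul_self : S.typProj N δ * S.typProj N δ = S.typProj N δ :=
  typicalProjector_mul_self _ _ _

theorem typProj_le_one : S.typProj N δ ≤ 1 := typicalProjector_le_one _ _ _

variable (c : TreeCode X N m) (u : Fin m) (k : Fin m → Bool)

theorem prefixSum_nonneg (v : ℕ) : 0 ≤ S.prefixSum δ c v k :=
  Finset.sum_nonneg fun _ _ => S.condTypProj_nonneg δ _

theorem prefixSum_update (b : Bool) :
    S.prefixSum δ c u (Function.update k u b) = S.prefixSum δ c u k := by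
  unfold prefixSum
  congr 1
  ext k'
  simp only [Finset.mem_filter, Finset.mem_univ, true_and]
  refine forall_congr' fun i => imp_congr_right fun hi => ?_
  rw [Function.update_of_ne (fun h => by simp [h] at hi)]

/-- The strings that agree with `k` on the bits below `u` are split by their bit `u`; completeness
of each step on the support of its parent rests on this. -/
theorem prefixSum_succ_add :
    S.prefixSum δ c (u + 1) (Function.update k u false)
      + S.prefixSum δ c (u + 1) (Function.update k u true) = S.prefixSum δ c u k := by
  have h : ∀ (b : Bool) (k' : Fin m → Bool),
      (∀ i : Fin m, (i : ℕ) < u + 1 → k' i = Function.update k u b i)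
        ↔ (∀ i : Fin m, (i : ℕ) < u → k' i = k i) ∧ k' u = b := by
    intro b k'
    constructor
    · refine fun hk => ⟨fun i hi => ?_, by simpa using hk u (Nat.lt_succ_self _)⟩
      have := hk i (hi.trans (Nat.lt_succ_self _))
      rwa [Function.update_of_ne (fun h => by simp [h] at hi)] at this
    · rintro ⟨h1, h2⟩ i hi
      rcases eq_or_ne i u with rfl | hne
      · simpa using h2
      · rw [Function.update_of_ne hne]
        exact h1 i (lt_of_le_of_ne (Nat.lt_succ_iff.1 hi) fun h => hne (Fin.ext h))
  simp only [prefixSum, h, Finset.sum_filter]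
  rw [← Finset.sum_add_distrib]
  refine Finset.sum_congr rfl fun k' _ => ?_
  by_cases hk : ∀ i : Fin m, (i : ℕ) < u → k' i = k i
  · cases h2 : k' u <;> simp
  · simp only [hk, false_and, if_false, add_zero]

theorem srmOperator_nonneg : 0 ≤ S.srmOperator δ c u k :=
  Matrix.conj_nonneg (S.prefixSum_nonneg δ c k _) (Matrix.pinvSqrt_isHermitian _)

theorem srmOperator_add :
    S.srmOperator δ c u (Function.update k u false) + S.srmOperator δ c u (Function.update k u true)
      = Matrix.supportProj (S.prefixSum δ c u k) := by
  simp only [srmOperator, prefixSum_update]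
  rw [← Matrix.add_mul, ← Matrix.mul_add, prefixSum_succ_add,
    Matrix.pinvSqrt_conj_self (S.prefixSum_nonneg δ c k _)]

theorem srmOperator_le_one : S.srmOperator δ c u k ≤ 1 := by
  refine le_trans ?_ (Matrix.supportProj_le_one (S.prefixSum δ c u k))
  rw [← srmOperator_add]
  have h := Function.update_eq_self u k
  cases hb : k u <;> rw [hb] at h <;> nth_rewrite 1 [← h]
  · exact le_add_of_nonneg_right (S.srmOperator_nonneg δ c u _)
  · exact le_add_of_nonneg_left (S.srmOperator_nonneg δ c u _)

theorem condTypProj_le_prefixSum (v : ℕ) : S.condTypProj δ (c k) ≤ S.prefixSum δ c v k :=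
  Finset.single_le_sum (f := fun k' => S.condTypProj δ (c k'))
    (fun k' _ => S.condTypProj_nonneg δ (c k')) (by simp)

theorem prefixSum_sub_condTypProj_le (v : ℕ) :
    S.prefixSum δ c v k - S.condTypProj δ (c k)
      ≤ ∑ k' ∈ Finset.univ.erase k, S.condTypProj δ (c k') := by
  rw [sub_le_iff_le_add, Finset.sum_erase_add _ _ (Finset.mem_univ k)]
  exact Finset.sum_le_sum_of_subset_of_nonneg (Finset.filter_subset _ _)
    fun k' _ _ => S.condTypProj_nonneg δ (c k')

/-- The error of one step: atypicality of the state, and interference of the other codewords. -/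
theorem one_sub_trace_srmOperator_le :
    1 - (S.srmOperator δ c u k
        * (S.typProj N δ * S.codewordState (c k) * S.typProj N δ)).trace.re
      ≤ 5 * ((1 - S.typProj N δ) * S.codewordState (c k)).trace.re
        + 4 * ((1 - S.condTypProj δ (c k)) * S.codewordState (c k)).trace.re
        + 4 * ∑ k' ∈ Finset.univ.erase k, (S.condTypProj δ (c k')
            * (S.typProj N δ * S.codewordState (c k) * S.typProj N δ)).trace.re := by
  -- Only the sent codeword's own projector is kept from the child sum; the rest is positive and can
  -- only help acceptance.
  have h1 : pinvSqrt (S.prefixSum δ c u k) * S.condTypProj δ (c k)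
      * pinvSqrt (S.prefixSum δ c u k) ≤ S.srmOperator δ c u k := by
    have h := Matrix.conj_nonneg (sub_nonneg.2 (S.condTypProj_le_prefixSum δ c k (u + 1)))
      (Matrix.pinvSqrt_isHermitian (S.prefixSum δ c u k))
    rw [Matrix.mul_sub, Matrix.sub_mul] at h
    exact sub_nonneg.1 h
  have h2 := (sub_le_sub_left h1 1).trans <|
    (Matrix.hayashi_nagaoka (S.condTypProj_nonneg δ _) (S.condTypProj_mul_self δ _)
      (S.condTypProj_le_prefixSum δ c k u)).trans <|
    add_le_add le_rfl (nsmul_le_nsmul_right (S.prefixSum_sub_condTypProj_le δ c k u) 4)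
  have h3 := Matrix.one_sub_trace_le_of_hayashi_nagaoka h2 (S.condTypProj_nonneg δ _)
    (S.condTypProj_le_one δ _) (S.typProj_nonneg δ) (S.typProj_mul_self δ)
    (S.codewordState_nonneg (c k)) (S.codewordState_trace (c k))
  rwa [Finset.sum_mul, Matrix.trace_sum, Complex.re_sum] at h3

end Operators

/-! ### Exponential error bounds and the limit of the success probability. -/

section Asymptotic

variable {N m : ℕ} (δ : ℝ)

/-- The packing estimate: average over the sent word `x` first, with `z` fixed. The rank bound on
the projector of `z` holds for every `z`, typical or not. -/
theorem sum_seqProb_interference_le :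
    ∑ x, S.seqProb x * ∑ z, S.seqProb z
        * (S.condTypProj δ z * (S.typProj N δ * S.codewordState x * S.typProj N δ)).trace.re
      ≤ (2 : ℝ) ^ (-(N * (S.holevoInfo - 2 * δ))) := by
  set Q := S.typProj N δ with hQ
  have h1 : ∀ z : Fin N → X,
      ∑ x, S.seqProb x * (S.condTypProj δ z * (Q * S.codewordState x * Q)).trace.re
        ≤ (2 : ℝ) ^ (-(N * (S.holevoInfo - 2 * δ))) := by
    intro z
    have e : ∀ M : Matrix (Fin N → d) (Fin N → d) ℂ, (S.condTypProj δ z * (Q * M * Q)).trace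
        = (Q * S.condTypProj δ z * Q * M).trace := by
      intro M
      rw [← Matrix.mul_assoc, Matrix.trace_mul_comm]
      simp only [Matrix.mul_assoc]
    simp only [e]
    rw [S.sum_seqProb_mul_trace, ← e, Matrix.trace_mul_comm]
    refine (Matrix.trace_mul_re_mono (typicalProjector_conj_tensorMatrix_le _ _ _)
      (S.condTypProj_nonneg δ z)).trans ?_
    rw [smul_mul_assoc, Matrix.one_mul, Matrix.trace_smul, smul_eq_mul, Complex.re_ofReal_mul]
    refine (mul_le_mul_of_nonneg_left (trace_typicalProjector_le _ _ _
      (fun n => S.state_posSemidef (z n)) fun n => S.state_trace (z n))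
      (Real.rpow_nonneg zero_le_two _)).trans (le_of_eq ?_)
    rw [← Real.rpow_add two_pos]
    congr 1
    rw [holevoInfo]; ring
  calc _ = ∑ z, S.seqProb z * ∑ x, S.seqProb x
        * (S.condTypProj δ z * (Q * S.codewordState x * Q)).trace.re := by
        simp only [Finset.mul_sum]
        rw [Finset.sum_comm]
        simp only [mul_left_comm]
    _ ≤ ∑ z : Fin N → X, S.seqProb z * (2 : ℝ) ^ (-(N * (S.holevoInfo - 2 * δ))) :=
        Finset.sum_le_sum fun z _ => mul_le_mul_of_nonneg_left (h1 z) (S.seqProb_nonneg z)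
    _ = _ := by rw [← Finset.sum_mul, sum_seqProb, one_mul]

theorem sum_eigenvalues_eq_one {A : Matrix d d ℂ} (hA : A.IsHermitian) (h1 : A.trace = 1) :
    ∑ j, hA.eigenvalues j = 1 := by
  have h := hA.trace_eq_sum_eigenvalues
  rw [h1] at h
  simpa using (congrArg Complex.re h).symm

variable {δ}

theorem mul_le_abs_of_not_isTypicalSequence {A : Fin N → Matrix d d ℂ}
    {hA : ∀ n, (A n).IsHermitian} {h : ℝ} {j : Fin N → d} (hj : ¬ IsTypicalSequence hA h δ j)
    (hpos : ∀ n, 0 < (hA n).eigenvalues (j n)) :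
    N * δ ≤ |∑ n, (-Real.logb 2 ((hA n).eigenvalues (j n)) - h)| := by
  rcases Nat.eq_zero_or_pos N with rfl | hN
  · simp
  · have hN' : (0 : ℝ) < N := Nat.cast_pos.2 hN
    have h1 := lt_of_not_ge fun h' => hj ⟨hpos, h'⟩
    have e : ∑ n, (-Real.logb 2 ((hA n).eigenvalues (j n)) - h)
        = N * (-(1 / (N : ℝ)) * ∑ n, Real.logb 2 ((hA n).eigenvalues (j n)) - h) := by
      rw [Finset.sum_sub_distrib, Finset.sum_neg_distrib]
      simp only [Finset.sum_const, Finset.card_univ, Fintype.card_fin, nsmul_eq_mul]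
      field_simp
    rw [e, abs_mul, abs_of_pos hN']
    exact mul_le_mul_of_nonneg_left h1.le hN'.le

/-- The eigenvalues of the average state are a letter distribution for which -log λ has mean S(ρ).
-/
theorem exists_typProj_bound (hδ : 0 < δ) : ∃ r : ℝ, 0 < r ∧ r < 1 ∧ ∀ N : ℕ,
    ∑ x : Fin N → X, S.seqProb x * ((1 - S.typProj N δ) * S.codewordState x).trace.re
      ≤ 2 * r ^ N := by
  classical
  set hA := S.avgState_isHermitian
  have hs := sum_eigenvalues_eq_one hA S.avgState_trace
  obtain ⟨r, hr, hr1, h⟩ := exists_tail_bound (q := hA.eigenvalues)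
    (fun j => S.avgState_posSemidef.eigenvalues_nonneg j) hs
    (g := fun j => -Real.logb 2 (hA.eigenvalues j) - S.avgStateEntropy)
    (by
      simp only [mul_sub, mul_neg, Finset.sum_sub_distrib, Finset.sum_neg_distrib]
      rw [← Finset.sum_mul, hs, one_mul]
      exact sub_self _) hδ
  refine ⟨r, hr, hr1, fun N => ?_⟩
  rw [S.sum_seqProb_mul_trace, typProj, trace_one_sub_typicalProjector_mul]
  exact h N _ fun j hj hpos => mul_le_abs_of_not_isTypicalSequence hj hpos

/-- The letters are now pairs (x, j) with weight p_x λ_{x,j}. Typicality refers to the averaged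
entropy ∑ p_x S(ρ_x), the mean of -log λ in this joint law, so one tail bound covers the randomness
of both the codeword and the eigenvector. -/
theorem exists_condTypProj_bound (hδ : 0 < δ) : ∃ r : ℝ, 0 < r ∧ r < 1 ∧ ∀ N : ℕ,
    ∑ x : Fin N → X, S.seqProb x * ((1 - S.condTypProj δ x) * S.codewordState x).trace.re
      ≤ 2 * r ^ N := by
  classical
  set hA := fun x => (S.state_posSemidef x).isHermitian
  have hs := fun x => sum_eigenvalues_eq_one (hA x) (S.state_trace x)
  have hq1 : ∑ a : X × d, S.prob a.1 * (hA a.1).eigenvalues a.2 = 1 := by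
    rw [Fintype.sum_prod_type]
    simp only [← Finset.mul_sum, hs, mul_one, S.prob_sum]
  obtain ⟨r, hr, hr1, h⟩ := exists_tail_bound
    (q := fun a : X × d => S.prob a.1 * (hA a.1).eigenvalues a.2)
    (fun a => mul_nonneg (S.prob_nonneg _) ((S.state_posSemidef a.1).eigenvalues_nonneg _)) hq1
    (g := fun a => -Real.logb 2 ((hA a.1).eigenvalues a.2) - S.condEntropy)
    (by
      simp only [mul_sub, Finset.sum_sub_distrib]
      rw [← Finset.sum_mul, hq1, one_mul, Fintype.sum_prod_type, sub_eq_zero, condEntropy]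
      refine Finset.sum_congr rfl fun x _ => ?_
      rw [vonNeumannEntropy, ← Finset.sum_neg_distrib, Finset.mul_sum]
      exact Finset.sum_congr rfl fun j _ => by ring) hδ
  refine ⟨r, hr, hr1, fun N => ?_⟩
  refine le_trans (le_of_eq ?_) (h N (fun a => ¬ IsTypicalSequence
    (fun n => hA (a n).1) S.condEntropy δ fun n => (a n).2) fun a ha hpos => ?_)
  · rw [Finset.sum_filter, ← (Equiv.arrowProdEquivProdArrow (Fin N) (fun _ => X)
      fun _ => d).symm.sum_comp, Fintype.sum_prod_type]
    refine Finset.sum_congr rfl fun x _ => ?_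
    rw [condTypProj, codewordState, trace_one_sub_typicalProjector_mul, Finset.sum_filter,
      Finset.mul_sum]
    refine Finset.sum_congr rfl fun j _ => ?_
    rw [mul_ite, mul_zero]
    refine if_congr Iff.rfl ?_ rfl
    rw [seqProb, eigenWeight, ← Finset.prod_mul_distrib]
    rfl
  · exact mul_le_abs_of_not_isTypicalSequence ha fun n =>
      pos_of_mul_pos_right (hpos n) (S.prob_nonneg _)

/-- The average error of one step. -/
theorem codeAverage_one_sub_le (u : Fin m) (k : Fin m → Bool) :
    S.codeAverage (fun c : TreeCode X N m => 1 - (S.srmOperator δ c u k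
        * (S.typProj N δ * S.codewordState (c k) * S.typProj N δ)).trace.re)
      ≤ 5 * ∑ x : Fin N → X, S.seqProb x * ((1 - S.typProj N δ) * S.codewordState x).trace.re
        + 4 * ∑ x : Fin N → X, S.seqProb x
            * ((1 - S.condTypProj δ x) * S.codewordState x).trace.re
        + 4 * (2 ^ m * (2 : ℝ) ^ (-(N * (S.holevoInfo - 2 * δ)))) := by
  refine (S.codeAverage_mono fun c => S.one_sub_trace_srmOperator_le δ c u k).trans ?_
  rw [codeAverage_add, codeAverage_add, codeAverage_mul_left, codeAverage_mul_left,
    codeAverage_mul_left, codeAverage_sum,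
    S.codeAverage_apply k fun x : Fin N → X => ((1 - S.typProj N δ) * S.codewordState x).trace.re,
    S.codeAverage_apply k fun x : Fin N → X => ((1 - S.condTypProj δ x) * S.codewordState x).trace.re]
  refine add_le_add le_rfl (mul_le_mul_of_nonneg_left ?_ zero_le_four)
  have h : ∀ k' ∈ Finset.univ.erase k, S.codeAverage (fun c : TreeCode X N m =>
      (S.condTypProj δ (c k')
        * (S.typProj N δ * S.codewordState (c k) * S.typProj N δ)).trace.re)
      ≤ (2 : ℝ) ^ (-(N * (S.holevoInfo - 2 * δ))) := fun k' hk' => by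
    rw [S.codeAverage_apply_apply (Finset.ne_of_mem_erase hk').symm
      fun x z : Fin N → X =>
      (S.condTypProj δ z * (S.typProj N δ * S.codewordState x * S.typProj N δ)).trace.re]
    exact S.sum_seqProb_interference_le δ
  refine (Finset.sum_le_card_nsmul _ _ _ h).trans ?_
  rw [nsmul_eq_mul]
  refine mul_le_mul_of_nonneg_right ?_ (Real.rpow_nonneg zero_le_two _)
  have := Finset.card_erase_le (s := (Finset.univ : Finset (Fin m → Bool))) (a := k)
  rw [Finset.card_univ, Fintype.card_fun, Fintype.card_bool, Fintype.card_fin] at this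
  exact_mod_cast this

theorem two_pow_numBits_mul_le {R : ℝ} (u : Fin (numBits R N)) (t : ℝ) :
    (2 : ℝ) ^ numBits R N * (2 : ℝ) ^ (-(N * t)) ≤ 2 * ((2 : ℝ) ^ (-(t - R))) ^ N := by
  -- The existence of a step `u` forces NR > 0; the ceiling then costs at most the factor 2.
  have hpos : 0 < (N : ℝ) * R := Nat.ceil_pos.1 (lt_of_le_of_lt (Nat.zero_le _) u.2)
  have h1 : (numBits R N : ℝ) < N * R + 1 := Nat.ceil_lt_add_one hpos.le
  rw [← Real.rpow_natCast, ← Real.rpow_natCast, ← Real.rpow_mul zero_le_two,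
    ← Real.rpow_add two_pos]
  calc (2 : ℝ) ^ ((numBits R N : ℝ) + -(N * t)) ≤ (2 : ℝ) ^ (1 + -(t - R) * N) :=
        Real.rpow_le_rpow_of_exponent_le one_le_two (by linarith)
    _ = _ := by rw [Real.rpow_add two_pos, Real.rpow_one]

theorem isLittleO_pow_inv_sq {r : ℝ} (hr : 0 ≤ r) (hr1 : r < 1) :
    (fun N : ℕ => r ^ N) =o[Filter.atTop] fun N : ℕ => ((N : ℝ) ^ 2)⁻¹ := by
  refine isLittleO_of_tendsto' ?_ ?_
  · filter_upwards [Filter.eventually_ge_atTop 1] with N hN h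
    have : (N : ℝ) ≠ 0 := by positivity
    simp [this] at h
  · refine (tendsto_pow_const_mul_const_pow_of_lt_one 2 hr hr1).congr fun N => ?_
    rw [div_inv_eq_mul, mul_comm]

/-- The error of every step, averaged over codes, is bounded by a common `o(N⁻²)` sequence. -/
theorem exists_error_bound {R : ℝ} (hδ : 0 < δ) (hR : R < S.holevoInfo - 2 * δ) :
    ∃ ε : ℕ → ℝ, (∀ N, 0 < ε N) ∧ ε =o[Filter.atTop] (fun N : ℕ => ((N : ℝ) ^ 2)⁻¹) ∧
      (∀ N : ℕ, ∑ x : Fin N → X,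
        S.seqProb x * ((1 - S.typProj N δ) * S.codewordState x).trace.re ≤ ε N) ∧
      ∀ (N : ℕ) (u : Fin (numBits R N)) (k : Fin (numBits R N) → Bool),
        S.codeAverage (fun c : TreeCode X N (numBits R N) => 1 - (S.srmOperator δ c u k
          * (S.typProj N δ * S.codewordState (c k) * S.typProj N δ)).trace.re) ≤ ε N := by
  obtain ⟨r, hr, hr1, h⟩ := S.exists_typProj_bound hδ
  obtain ⟨r', hr', hr1', h'⟩ := S.exists_condTypProj_bound hδ
  set a : ℝ := (2 : ℝ) ^ (-(S.holevoInfo - 2 * δ - R)) with ha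
  have ha0 : 0 < a := Real.rpow_pos_of_pos two_pos _
  have ha1 : a < 1 := Real.rpow_lt_one_of_one_lt_of_neg one_lt_two (by linarith)
  -- The one-step weights 5, 4, 4, each times 2: from the two-sided tails in the first two terms,
  -- from rounding up the number of bits in the last.
  refine ⟨fun N => 10 * r ^ N + 8 * r' ^ N + 8 * a ^ N, fun N => by positivity,
    (((isLittleO_pow_inv_sq hr.le hr1).const_mul_left _).add
      ((isLittleO_pow_inv_sq hr'.le hr1').const_mul_left _)).add
      ((isLittleO_pow_inv_sq ha0.le ha1).const_mul_left _), fun N => ?_, fun N u k => ?_⟩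
  · have := h N
    have : 0 < r ^ N := by positivity
    have : 0 < r' ^ N := by positivity
    have : 0 < a ^ N := by positivity
    linarith
  · have h1 := S.codeAverage_one_sub_le (δ := δ) (N := N) u k
    have h2 := two_pow_numBits_mul_le (N := N) u (S.holevoInfo - 2 * δ)
    linarith [h N, h' N]

theorem successProb_le_one (c : TreeCode X N m) : S.successProb c (S.srmOperator δ c) ≤ 1 := by
  rw [successProb, one_div, inv_mul_le_iff₀ (by positivity), mul_one]
  refine (Finset.sum_le_card_nsmul _ _ 1 fun k _ => Matrix.trace_nestedElement_le
    (fun u => S.srmOperator_nonneg δ c u k) (fun u => S.srmOperator_le_one δ c u k)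
    (S.codewordState_nonneg _) (S.codewordState_trace _)).trans (le_of_eq ?_)
  simp

/-- The errors are bounded by s², so after averaging each displacement is at most `s`: two from the
projection and one from each of the `m` steps. -/
theorem le_codeAverage_successProb {s : ℝ} (hs : 0 < s)
    (h : ∑ x : Fin N → X, S.seqProb x * ((1 - S.typProj N δ) * S.codewordState x).trace.re ≤ s ^ 2)
    (h' : ∀ (u : Fin m) (k : Fin m → Bool),
      S.codeAverage (fun c : TreeCode X N m => 1 - (S.srmOperator δ c u k
        * (S.typProj N δ * S.codewordState (c k) * S.typProj N δ)).trace.re) ≤ s ^ 2) :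
    1 - 2 * (2 * s + m * s)
      ≤ S.codeAverage fun c : TreeCode X N m => S.successProb c (S.srmOperator δ c) := by
  simp only [successProb]
  rw [codeAverage_mul_left, codeAverage_sum, one_div, ← div_eq_inv_mul, le_div_iff₀ (by positivity)]
  have key : ∀ k : Fin m → Bool, 1 - 2 * (2 * s + m * s) ≤ S.codeAverage fun c : TreeCode X N m =>
      (nestedElement (fun u => S.srmOperator δ c u k) * S.codewordState (c k)).trace.re := by
    intro k
    have hQ := S.typProj_nonneg (N := N) δ
    have hσ : ∀ c : TreeCode X N m,
        0 ≤ S.typProj N δ * S.codewordState (c k) * S.typProj N δ := fun c =>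
      Matrix.conj_nonneg (S.codewordState_nonneg _) (Matrix.nonneg_iff_posSemidef.1 hQ).1
    have hσ1 : ∀ c : TreeCode X N m,
        (S.typProj N δ * S.codewordState (c k) * S.typProj N δ).trace.re ≤ 1 := fun c => by
      rw [Matrix.trace_mul_comm, ← Matrix.mul_assoc, S.typProj_mul_self]
      refine (Matrix.trace_mul_re_mono (S.typProj_le_one δ) (S.codewordState_nonneg _)).trans ?_
      rw [Matrix.one_mul, S.codewordState_trace]; rfl
    have h1 : ∀ c : TreeCode X N m, 1 - 2 * (2 * √(((1 - S.typProj N δ)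
          * S.codewordState (c k)).trace.re) + ∑ u, √(1 - (S.srmOperator δ c u k
            * (S.typProj N δ * S.codewordState (c k) * S.typProj N δ)).trace.re))
        ≤ (nestedElement (fun u => S.srmOperator δ c u k) * S.codewordState (c k)).trace.re :=
      fun c => by
        -- The trace of the projected state is at most 1, so putting 1 in its place only weakens the
        -- bound.
        refine le_trans ?_ (Matrix.one_sub_le_trace_nestedElement
          (fun u => S.srmOperator_nonneg δ c u k) (fun u => S.srmOperator_le_one δ c u k) hQ
          (S.typProj_mul_self δ) (S.codewordState_nonneg _) (S.codewordState_trace _))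
        gcongr
        exact hσ1 c
    refine le_trans ?_ (S.codeAverage_mono h1)
    rw [codeAverage_sub, codeAverage_const, codeAverage_mul_left, codeAverage_add,
      codeAverage_mul_left, codeAverage_sum]
    have h2 := S.codeAverage_sqrt_le (m := m) (f := fun c => ((1 - S.typProj N δ)
        * S.codewordState (c k)).trace.re)
      (fun c => Matrix.trace_mul_re_nonneg (sub_nonneg.2 (S.typProj_le_one δ))
        (S.codewordState_nonneg _)) hs
      (by rwa [S.codeAverage_apply k fun x : Fin N → X =>
        ((1 - S.typProj N δ) * S.codewordState x).trace.re])
    have h3 : ∀ u : Fin m, _ := fun u => S.codeAverage_sqrt_le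
      (f := fun c : TreeCode X N m => 1 - (S.srmOperator δ c u k
        * (S.typProj N δ * S.codewordState (c k) * S.typProj N δ)).trace.re)
      (fun c => sub_nonneg.2 ((Matrix.trace_mul_re_mono (S.srmOperator_le_one δ c u k)
        (hσ c)).trans (by rw [Matrix.one_mul]; exact hσ1 c))) hs (h' u k)
    have h4 := Finset.sum_le_card_nsmul Finset.univ _ s fun u _ => h3 u
    rw [Finset.card_univ, Fintype.card_fin, nsmul_eq_mul] at h4
    linarith
  have h5 := Finset.card_nsmul_le_sum Finset.univ _ _ fun k _ => key k
  rw [Finset.card_univ, Fintype.card_fun, Fintype.card_bool, Fintype.card_fin, nsmul_eq_mul] at h5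
  push_cast at h5
  linarith

theorem tendsto_codeAverage_successProb {R : ℝ} (hδ : 0 < δ) (hR : R < S.holevoInfo - 2 * δ) :
    Filter.Tendsto (fun N : ℕ => S.codeAverage fun c : TreeCode X N (numBits R N) =>
      S.successProb c (S.srmOperator δ c)) Filter.atTop (𝓝 1) := by
  obtain ⟨ε, hε, hεo, h, h'⟩ := S.exists_error_bound hδ hR
  have hlim : Filter.Tendsto (fun N : ℕ => √((N : ℝ) ^ 2 * ε N)) Filter.atTop (𝓝 0) := by
    have h1 := hεo.tendsto_div_nhds_zero
    have h2 := (Real.continuous_sqrt.tendsto 0).comp h1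
    rw [Real.sqrt_zero] at h2
    refine h2.congr fun N => ?_
    simp only [Function.comp_apply, div_inv_eq_mul, mul_comm]
  -- For N ≥ 1 the count 2 + m is at most 3 + N|R| ≤ (3 + |R|)N; the absolute value also covers
  -- negative rates.
  have hlow : Filter.Tendsto (fun N : ℕ => 1 - 2 * ((3 + |R|) * √((N : ℝ) ^ 2 * ε N)))
      Filter.atTop (𝓝 1) := by
    simpa using ((hlim.const_mul (3 + |R|)).const_mul 2).const_sub 1
  refine tendsto_of_tendsto_of_tendsto_of_le_of_le' hlow tendsto_const_nhds ?_ ?_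
  · filter_upwards [Filter.eventually_ge_atTop 1] with N hN
    have hs : 0 < √(ε N) := Real.sqrt_pos.2 (hε N)
    refine le_trans ?_ (S.le_codeAverage_successProb hs
      (by rw [Real.sq_sqrt (hε N).le]; exact h N)
      (by rw [Real.sq_sqrt (hε N).le]; exact h' N))
    have hN' : (1 : ℝ) ≤ N := by exact_mod_cast hN
    rw [Real.sqrt_mul (sq_nonneg _), Real.sqrt_sq (Nat.cast_nonneg _)]
    have hm : (numBits R N : ℝ) ≤ N * |R| + 1 := by
      have h1 : numBits R N ≤ ⌈(N : ℝ) * |R|⌉₊ :=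
        Nat.ceil_mono (mul_le_mul_of_nonneg_left (le_abs_self R) (Nat.cast_nonneg N))
      have h2 : ((⌈(N : ℝ) * |R|⌉₊ : ℕ) : ℝ) < N * |R| + 1 := Nat.ceil_lt_add_one (by positivity)
      exact (Nat.cast_le.2 h1).trans h2.le
    have h3 : 2 + (numBits R N : ℝ) ≤ (3 + |R|) * N := by nlinarith
    have h4 := mul_le_mul_of_nonneg_right h3 hs.le
    linarith
  · refine Filter.Eventually.of_forall fun N => ?_
    refine (S.codeAverage_mono fun c => S.successProb_le_one c).trans (le_of_eq ?_)
    exact S.codeAverage_const 1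

end Asymptotic

end QuantumSource

end

theorem lemma5 {X d : Type*} [Fintype X] [Fintype d] [DecidableEq d] (S : QuantumSource X d)
    (R : ℝ) (_hR : R < S.holevoInfo) :
    (∃ δ : ℝ, 0 < δ ∧ R < S.holevoInfo - 2 * δ) ∧
    ∀ δ : ℝ, 0 < δ → R < S.holevoInfo - 2 * δ →
      -- each step is a measurement, complete on the support of the parent sum operator
      (∀ (N m : ℕ) (c : TreeCode X N m) (u : Fin m) (k : Fin m → Bool),
        (∀ b : Bool, (S.srmOperator δ c u (Function.update k u b)).PosSemidef) ∧
        (1 - S.srmOperator δ c u (Function.update k u false)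
          - S.srmOperator δ c u (Function.update k u true)).PosSemidef ∧
        (S.srmOperator δ c u (Function.update k u false)
          + S.srmOperator δ c u (Function.update k u true)) * S.prefixSum δ c u k
            = S.prefixSum δ c u k) ∧
      -- the sufficient condition
      S.SufficientCondition R δ (S.srmOperator δ) ∧
      -- the average success probability converges to one
      Filter.Tendsto
        (fun N : ℕ => S.codeAverage fun c : TreeCode X N (QuantumSource.numBits R N) =>
          S.successProb c (S.srmOperator δ c))
        Filter.atTop (𝓝 1) := by
  -- With this δ, 2δ is half of the gap χ - R.
  refine ⟨⟨(S.holevoInfo - R) / 4, by linarith, by linarith⟩, fun δ hδ hR => ⟨?_, ?_, ?_⟩⟩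
  · intro N m c u k
    refine ⟨fun b => ?_, ?_, ?_⟩
    · open scoped MatrixOrder in
      exact Matrix.nonneg_iff_posSemidef.1 (S.srmOperator_nonneg δ c u _)
    · rw [sub_sub, S.srmOperator_add]
      open scoped MatrixOrder in
      exact Matrix.le_iff.1 (Matrix.supportProj_le_one _)
    · rw [S.srmOperator_add]
      exact Matrix.supportProj_mul_self (S.prefixSum_nonneg δ c k _)
  · obtain ⟨ε, hε, hεo, -, h⟩ := S.exists_error_bound hδ hR
    refine ⟨ε, hε, hεo, fun N u k => ?_⟩
    have h1 := h N u k
    rw [S.codeAverage_sub, S.codeAverage_const] at h1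
    linarith
  · exact S.tendsto_codeAverage_successProb hδ hR
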